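/- **Setting.** Fix a capacity $k\ge 1$ and a stream of items $1,2,\dots$ with weights $w_i>0$. A reservoir $R_j$ of at most $k$ of the first $j$ items is maintained together with adjusted weights $\tilde w_i$ and a threshold $\tau_j$. For $j\le k$ we have $R_j=\{1,\dots,j\}$, $\tilde w_i=w_i$ and $\tau_j=0$. For $j>k$, item $j$ is added with $\tilde w_j=w_j$, giving $R^{\mathrm{pre}}_j=R_{j-1}\cup\{j\}$ with $k+1$ items; $\tau_j=\tau$ is the number $\tau>0$ with $\sum_{i\in R^{\mathrm{pre}}_j}\min\{1,\tilde w_i/\tau\}=k$; for $r_j\in(0,1)$ uniformly random, and $\tilde w_{(1)}\le\dots\le\tilde w_{(k+1)}$ the adjusted weights in $R^{\mathrm{pre}}_j$ in sorted order (ties broken arbitrarily), the item dropped is the one with the smallest index $d$ with $\tilde w_{(d)}\le\tau$ and $\sum_{x\le d}(1-\tilde w_{(x)}/\tau)\ge r_j$; the remaining $k$ items form $R_j$, with new adjusted weights $\max\{\tilde w_i,\tau\}$. **Implementation.** $R_j$ is stored as two height-balanced binary trees: $L$, holding the large items ($w_i>\tau_j$, $\tilde w_i=w_i$) sorted by weight,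 and $T$, holding the small items ($w_i\le\tau_j$, $\tilde w_i=\tau_j$) in arbitrary order. Each node stores the height, the number of items and the total weight of its subtree. Joining, splitting at a position, concatenation, insertion and deletion are done by the usual rebalancing with rotations. While fewer than $k$ items are stored, a new item is inserted into $L$. Otherwise item $j$ is processed as follows. If $w_j>\tau_{j-1}$, insert $j$ into $L$. Descend from the root of $L$, accumulating counts and sums (starting from those of $T$, and of $j$ if $w_j\le\tau_{j-1}$), to find the largest $t$ with $\sum_{x\le t}\tilde w_{(x)}\ge(t-1)\tilde w_{(t)}$, and set $\tau_j=\big(\sum_{x\le t}\tilde w_{(x)}\big)/(t-1)$. Find the smallest $d\le t$ with $d\,\tau_j-\sum_{x\le d}\tilde w_{(x)}\ge r_j\tau_j$ by first considering $j$ if $w_j\le\tau_{j-1}$ and then descending in $T$ or in $L$ in the same way. If $w_j\le\tau_{j-1}$, insert $j$ into $T$. Delete the $d$-th item from its tree. If the $t$-th item was in $L$, split off the prefix of $L$ consisting of the items of rank at most $t$ and concatenate it to $T$. Time is the number of elementary operations, each of unit cost: arithmetic and comparison of real numbers and counters, and reading, inspecting or allocating a tree node. **Theorem.** The implementation is correct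 and processes each item in $O(\log k)$ worst-case time. That is, there is an absolute constant $C$ such that for every $k\ge1$, all positive weights $w_1,w_2,\dots$, all $r_1,r_2,\dots\in(0,1)$ and every $j\ge1$: 1. item $j$ is processed in at most $C\log(k+1)$ time; 2. before and after processing item $j$, the two trees are height-balanced, store correct heights, counts and sums, and represent the current reservoir as described, with $\min\{n,k\}$ distinct items after $n$ items; and whenever $n>k$ items have been seen, the stored threshold satisfies $\tau_n>0$ and $\sum_{i\le n}\min\{1,w_i/\tau_n\}=k$; 3. if $j\le k$, item $j$ is added to the reservoir with adjusted weight $w_j$, and the other items and adjusted weights are unchanged; if $j>k$, then $\tau_j$, $R_j$ and its adjusted weights arise from $R_{j-1}$, item $j$ and $r_j$ by the sampling rule of the setting; moreover, for a uniformly random $r_j\in(0,1)$ (with the earlier $r_i$ fixed), each $i\in R^{\mathrm{pre}}_j$ is dropped with probability $1-\min\{1,\tilde w_i/\tau_j\}$. -/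

import Mathlib

open MeasureTheory

noncomputable section

namespace VarOpt

/-! ### Step counting on a real RAM

A computation returns a value together with the number of elementary operations performed.  The
unit-cost elementary operations are exactly the ones listed below: arithmetic and comparisons of
real numbers and of integer counters, reading a field stored at the root of a tree, inspecting or
allocating a tree node.  All programs below are built from these with `pure` (cost `0`) and the
monadic `bind` (costs add up). -/

/-- A value together with the number of elementary steps used to compute it. -/
structure Timed (α : Type) where
  val : α
  time : ℕ

instance : Monad Timed where
  pure a := ⟨a, 0⟩
  bind m f := ⟨(f m.val).val, m.time + (f m.val).time⟩

/-- One elementary step with result `a`. -/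
def step {α : Type} (a : α) : Timed α := ⟨a, 1⟩

def radd (a b : ℝ) : Timed ℝ := step (a + b)
def rsub (a b : ℝ) : Timed ℝ := step (a - b)
def rmul (a b : ℝ) : Timed ℝ := step (a * b)
def rdiv (a b : ℝ) : Timed ℝ := step (a / b)
def rle (a b : ℝ) : Timed Bool := step (decide (a ≤ b))
def rlt (a b : ℝ) : Timed Bool := step (decide (a < b))
def nadd (a b : ℕ) : Timed ℕ := step (a + b)
def nsub (a b : ℕ) : Timed ℕ := step (a - b)
def nmax (a b : ℕ) : Timed ℕ := step (max a b)
def nle (a b : ℕ) : Timed Bool := step (decide (a ≤ b))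
def nlt (a b : ℕ) : Timed Bool := step (decide (a < b))
def toReal (n : ℕ) : Timed ℝ := step (n : ℝ)

/-! ### Augmented balanced binary search trees -/

/-- An item of the stream: its index and its (original) weight. -/
structure Item where
  id : ℕ
  w : ℝ

/-- Binary trees of items.  A node stores, besides its two children and its item, the height of its
subtree, the number of items in its subtree, and their total weight. -/
inductive Tree where
  | nil : Tree
  | node (l : Tree) (x : Item) (r : Tree) (height size : ℕ) (total : ℝ) : Tree

namespace Tree

/-- Read the stored height. -/
def height : Tree → Timed ℕ
  | nil => step 0
  | node _ _ _ h _ _ => step h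

/-- Read the stored number of items. -/
def size : Tree → Timed ℕ
  | nil => step 0
  | node _ _ _ _ n _ => step n

/-- Read the stored total weight. -/
def total : Tree → Timed ℝ
  | nil => step 0
  | node _ _ _ _ _ s => step s

/-- Allocate a node with the given children and item, computing the stored fields. -/
def mk (l : Tree) (x : Item) (r : Tree) : Timed Tree := do
  let hl ← l.height
  let hr ← r.height
  let hm ← nmax hl hr
  let h ← nadd hm 1
  let nl ← l.size
  let nr ← r.size
  let nm ← nadd nl nr
  let n ← nadd nm 1
  let sl ← l.total
  let sr ← r.total
  let sm ← radd sl sr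
  let s ← radd sm x.w
  step (node l x r h n s)

/-- Node with children `l`, `t`, repaired by a single or double left rotation if `t` is too high. -/
def balR (l : Tree) (y : Item) (t : Tree) : Timed Tree := do
  let hl ← l.height
  let ht ← t.height
  let hl1 ← nadd hl 1
  let ok ← nle ht hl1
  if ok then mk l y t
  else
    match t with
    | nil => mk l y nil
    | node a z b _ _ _ => do
      let ha ← a.height
      let hb ← b.height
      let single ← nle ha hb
      if single then do
        let u ← mk l y a
        mk u z b
      else
        match a with
        | nil => mk l y t
        | node a₁ v a₂ _ _ _ => do
          let u₁ ← mk l y a₁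
          let u₂ ← mk a₂ z b
          mk u₁ v u₂

/-- Node with children `t`, `r`, repaired by a single or double right rotation if `t` is too
high. -/
def balL (t : Tree) (y : Item) (r : Tree) : Timed Tree := do
  let hr ← r.height
  let ht ← t.height
  let hr1 ← nadd hr 1
  let ok ← nle ht hr1
  if ok then mk t y r
  else
    match t with
    | nil => mk nil y r
    | node a z b _ _ _ => do
      let ha ← a.height
      let hb ← b.height
      let single ← nle hb ha
      if single then do
        let u ← mk b y r
        mk a z u
      else
        match b with
        | nil => mk t y r
        | node b₁ v b₂ _ _ _ => do
          let u₁ ← mk a z b₁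
          let u₂ ← mk b₂ y r
          mk u₁ v u₂

/-- Join `l`, `x`, `r` where `l` may be much higher than `r`: descend along the right spine
of `l`. -/
def joinR (l : Tree) (x : Item) (r : Tree) : Timed Tree :=
  match l with
  | nil => mk nil x r
  | node ll y lr h n s => do
    let hl ← (node ll y lr h n s).height
    let hr ← r.height
    let hr1 ← nadd hr 1
    let ok ← nle hl hr1
    if ok then mk (node ll y lr h n s) x r
    else do
      let t ← joinR lr x r
      balR ll y t

/-- Join `l`, `x`, `r` where `r` may be much higher than `l`: descend along the left spine
of `r`. -/
def joinL (l : Tree) (x : Item) (r : Tree) : Timed Tree :=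
  match r with
  | nil => mk l x nil
  | node rl y rr h n s => do
    let hr ← (node rl y rr h n s).height
    let hl ← l.height
    let hl1 ← nadd hl 1
    let ok ← nle hr hl1
    if ok then mk l x (node rl y rr h n s)
    else do
      let t ← joinL l x rl
      balL t y rr

/-- The list of `l`, then `x`, then the list of `r`, as one balanced tree. -/
def join (l : Tree) (x : Item) (r : Tree) : Timed Tree := do
  let hl ← l.height
  let hr ← r.height
  let c ← nle hr hl
  if c then joinR l x r else joinL l x r

/-- Split off the first `p` items. -/
def split (t : Tree) (p : ℕ) : Timed (Tree × Tree) :=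
  match t with
  | nil => step (nil, nil)
  | node l y r _ _ _ => do
    let nl ← l.size
    let c ← nle p nl
    if c then do
      let ab ← split l p
      let b ← join ab.2 y r
      pure (ab.1, b)
    else do
      let nl1 ← nadd nl 1
      let q ← nsub p nl1
      let ab ← split r q
      let a ← join l y ab.1
      pure (a, ab.2)

/-- Remove the first item of the tree with root item `x` and children `l`, `r`. -/
def popFirst (l : Tree) (x : Item) (r : Tree) : Timed (Item × Tree) :=
  match l with
  | nil => step (x, r)
  | node ll y lr _ _ _ => do
    let m ← popFirst ll y lr
    let t ← join m.2 x r
    pure (m.1, t)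

/-- Concatenate two trees. -/
def concat (a b : Tree) : Timed Tree :=
  match b with
  | nil => step a
  | node l x r _ _ _ => do
    let m ← popFirst l x r
    join a m.1 m.2

/-- Insert `x` after the first `p` items. -/
def insertAt (t : Tree) (p : ℕ) (x : Item) : Timed Tree := do
  let ab ← split t p
  join ab.1 x ab.2

/-- Delete the item that is preceded by exactly `p` items. -/
def deleteAt (t : Tree) (p : ℕ) : Timed Tree := do
  let ab ← split t p
  match ab.2 with
  | nil => step ab.1
  | node l x r _ _ _ => do
    let m ← popFirst l x r
    concat ab.1 m.2

/-- Binary search down from the root.  The counters `c` and `s` accumulate the number and the total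
weight of the items to the left of the current subtree (on top of given initial values).  At a node,
`test` is called with the count and the total weight up to and including the item of this node, and
with the weight of this item; the search goes right if the answer is `true`, left otherwise.
Returned are the count and the total weight of the items found to pass. -/
def search (test : ℕ → ℝ → ℝ → Timed Bool) (t : Tree) (c : ℕ) (s : ℝ) : Timed (ℕ × ℝ) :=
  match t with
  | nil => step (c, s)
  | node l x r _ _ _ => do
    let nl ← l.size
    let sl ← l.total
    let c' ← nadd c nl
    let c₁ ← nadd c' 1
    let s' ← radd s sl
    let s₁ ← radd s' x.w
    let right ← test c₁ s₁ x.w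
    if right then search test r c₁ s₁ else search test l c s

/-- The items from left to right. -/
def toList : Tree → List Item
  | nil => []
  | node l x r _ _ _ => l.toList ++ x :: r.toList

/-- The actual height. -/
def depth : Tree → ℕ
  | nil => 0
  | node l _ r _ _ _ => max l.depth r.depth + 1

/-- Height-balanced: at each node the heights of the two children differ by at most one. -/
def Balanced : Tree → Prop
  | nil => True
  | node l _ r _ _ _ =>
    l.depth ≤ r.depth + 1 ∧ r.depth ≤ l.depth + 1 ∧ l.Balanced ∧ r.Balanced

/-- Every node stores the correct height, number of items and total weight of its subtree. -/
def Augmented : Tree → Prop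
  | nil => True
  | node l x r h n s =>
    h = (node l x r h n s).depth ∧ n = (node l x r h n s).toList.length ∧
      s = ((node l x r h n s).toList.map Item.w).sum ∧ l.Augmented ∧ r.Augmented

end Tree

/-! ### The reservoir and the processing of an item -/

/-- The reservoir: the tree of large items, the tree of small items, and the current threshold. -/
structure State where
  large : Tree
  small : Tree
  thr : ℝ

/-- The empty reservoir, with threshold `0`. -/
def State.init : State := ⟨Tree.nil, Tree.nil, 0⟩

/-- Insert an item into a tree sorted by weight. -/
def insertSorted (t : Tree) (x : Item) : Timed Tree := do
  let p ← t.search (fun _ _ w => rle w x.w) 0 0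
  t.insertAt p.1 x

/-- The reservoir together with the new item: the tree of large items (including a new large item),
whether the new item is small, and the number and total adjusted weight of all small items
(including a new small item). -/
structure Pre where
  large : Tree
  isSmall : Bool
  count : ℕ
  sum : ℝ

/-- Classify the new item, and insert it if it is large. -/
def prepare (st : State) (x : Item) : Timed Pre := do
  let isSmall ← rle x.w st.thr
  let m ← st.small.size
  let mr ← toReal m
  let s ← rmul mr st.thr
  if isSmall then do
    let b ← nadd m 1
    let s' ← radd s x.w
    pure ⟨st.large, true, b, s'⟩
  else do
    let l ← insertSorted st.large x
    pure ⟨l, false, m, s⟩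

/-- Find the largest `t` such that the `t`-th smallest adjusted weight `w` is at most the new
threshold, that is `(t - 1) * w ≤` the sum of the `t` smallest adjusted weights.  Returns `t` and
this sum. -/
def findCut (pre : Pre) : Timed (ℕ × ℝ) :=
  pre.large.search
    (fun c s w => do
      let c' ← nsub c 1
      let cr ← toReal c'
      let a ← rmul cr w
      rle a s)
    pre.count pre.sum

/-- `c * τ - s`. -/
def excess (τ : ℝ) (c : ℕ) (s : ℝ) : Timed ℝ := do
  let cr ← toReal c
  let a ← rmul cr τ
  rsub a s

/-- Search for the item to drop among the old small items and the large items.  Here `c₀` and `a₀`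
are the number and total weight of the items in front of the old small items (a new small item, if
any), `τ` is the new threshold and `ρ = r * τ`.  Returned is the number of items in front of the
item to drop. -/
def findDropOld (st : State) (pre : Pre) (τ ρ : ℝ) (c₀ : ℕ) (a₀ : ℝ) : Timed ℕ := do
  let e ← excess τ pre.count pre.sum
  let inSmall ← rle ρ e
  if inSmall then do
    let res ← st.small.search
      (fun c _ _ => do
        let m ← nsub c c₀
        let mr ← toReal m
        let a ← rmul mr st.thr
        let s ← radd a₀ a
        let v ← excess τ c s
        rlt v ρ)
      c₀ 0
    pure res.1
  else do
    let res ← pre.large.search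
      (fun c s w => do
        let below ← rle w τ
        if below then do
          let v ← excess τ c s
          rlt v ρ
        else pure false)
      pre.count pre.sum
    pure res.1

/-- Find the item to drop for the random number `r`, considering first the new item if it is small.
Returned is the number of items in front of the item to drop, in the order: new item (if small), old
small items, large items. -/
def findDrop (st : State) (x : Item) (pre : Pre) (τ r : ℝ) : Timed ℕ := do
  let ρ ← rmul r τ
  if pre.isSmall then do
    let q ← rsub τ x.w
    let first ← rle ρ q
    if first then step 0 else findDropOld st pre τ ρ 1 x.w
  else findDropOld st pre τ ρ 0 0

/-- Insert a small new item into the tree of small items. -/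
def insertSmall (st : State) (x : Item) (pre : Pre) : Timed Tree :=
  if pre.isSmall then st.small.insertAt 0 x else pure st.small

/-- Delete the item with `p` items in front of it from the tree containing it.  Returns the tree of
small items, the tree of large items, and how many of the latter became small, when `t` is the total
number of items before deletion that are now small. -/
def dropItem (sm : Tree) (pre : Pre) (t p : ℕ) : Timed (Tree × Tree × ℕ) := do
  let c ← nlt p pre.count
  let m ← nsub t pre.count
  if c then do
    let sm' ← sm.deleteAt p
    pure (sm', pre.large, m)
  else do
    let q ← nsub p pre.count
    let la ← pre.large.deleteAt q
    let m' ← nsub m 1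
    pure (sm, la, m')

/-- Process item `x` when the reservoir is full. -/
def processFull (st : State) (x : Item) (r : ℝ) : Timed State := do
  let pre ← prepare st x
  let cut ← findCut pre
  let t' ← nsub cut.1 1
  let tr ← toReal t'
  let τ ← rdiv cut.2 tr
  let p ← findDrop st x pre τ r
  let sm ← insertSmall st x pre
  let res ← dropItem sm pre cut.1 p
  let moved ← nlt pre.count cut.1
  if moved then do
    let ab ← res.2.1.split res.2.2
    let sm' ← res.1.concat ab.1
    pure ⟨ab.2, sm', τ⟩
  else pure ⟨res.2.1, res.1, τ⟩

/-- Process item `x` of the stream with a reservoir of capacity `k` and random number `r`. -/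
def process (k : ℕ) (st : State) (x : Item) (r : ℝ) : Timed State := do
  let a ← st.large.size
  let b ← st.small.size
  let n ← nadd a b
  let filling ← nlt n k
  if filling then do
    let l ← insertSorted st.large x
    pure ⟨l, st.small, st.thr⟩
  else processFull st x r

/-- The reservoir after the first `j` items (numbered `0, …, j - 1`) of the stream with weights `w`,
using the random number `r i` when processing item `i`. -/
def run (k : ℕ) (w r : ℕ → ℝ) : ℕ → State
  | 0 => State.init
  | j + 1 => (process k (run k w r j) ⟨j, w j⟩ (r j)).val

/-! ### What the implementation has to compute -/

/-- The sampled items with their adjusted weights: the threshold for items in the tree of small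
items, the original weight for items in the tree of large items. -/
def State.sample (st : State) : List (ℕ × ℝ) :=
  st.small.toList.map (fun x => (x.id, st.thr)) ++ st.large.toList.map (fun x => (x.id, x.w))

/-- `st` represents a reservoir of capacity `k` for the first `j` items of a stream with
weights `w`. -/
structure Represents (k : ℕ) (w : ℕ → ℝ) (j : ℕ) (st : State) : Prop where
  large_balanced : st.large.Balanced
  small_balanced : st.small.Balanced
  large_augmented : st.large.Augmented
  small_augmented : st.small.Augmented
  large_sorted : (st.large.toList.map Item.w).Pairwise (· ≤ ·)
  large_items : ∀ x ∈ st.large.toList, x.id < j ∧ x.w = w x.id ∧ st.thr < x.w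
  small_items : ∀ x ∈ st.small.toList, x.id < j ∧ x.w = w x.id ∧ x.w ≤ st.thr
  nodup : (st.sample.map Prod.fst).Nodup
  card : st.sample.length = min j k
  thr_init : j ≤ k → st.thr = 0
  thr_pos : k < j → 0 < st.thr
  thr_eq : k < j → ∑ i ∈ Finset.range j, min 1 (w i / st.thr) = k

/-- One round of threshold sampling of `k` out of the `k + 1` weighted items in `pre`, driven
by `r`: `τ` is the threshold, and for some arrangement of the items in nondecreasing order of
adjusted weight, the item to drop is the first one, among those of adjusted weight at most `τ`, up
to which the drop probabilities `1 - a / τ` add up to at least `r`.  The items left get adjusted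
weight at least `τ`. -/
def IsRound (k : ℕ) (pre : List (ℕ × ℝ)) (r τ : ℝ) (post : List (ℕ × ℝ)) : Prop :=
  0 < τ ∧ (pre.map fun p => min 1 (p.2 / τ)).sum = k ∧
  ∃ l : List (ℕ × ℝ), l.Perm pre ∧ l.Pairwise (fun p q => p.2 ≤ q.2) ∧
    ∃ (d : ℕ) (hd : d < l.length), (l[d]'hd).2 ≤ τ ∧
      r ≤ ((l.take (d + 1)).map fun p => 1 - p.2 / τ).sum ∧
      (∀ e < d, ((l.take (e + 1)).map fun p => 1 - p.2 / τ).sum < r) ∧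
      post.Perm ((l.eraseIdx d).map fun p => (p.1, max p.2 τ))

end VarOpt

end

/-!
In a round, sort the `k + 1` adjusted weights and cut the list into the part `U` of weights at most
the new threshold `τ` and the rest `V`. The equation `∑ min 1 (a / τ) = k` says that the gaps
`τ - a`, for `a` in `U`, add up to exactly `τ`. Hence consecutive intervals of these lengths tile
`(0, τ]`, the number `r * τ` falls into exactly one of them, and the item owning that interval is
dropped; this is both the sampling rule and the reason for the drop probabilities.

A tree search only finds a boundary between an item passing the test and an item failing it. For
the cut, sortedness turns this local information into `a ≤ τ` for all of `U` and `τ < a` for all of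
`V`.

After the round `U` has become `|U| - 1` items of adjusted weight `τ`, with the same total as
before. So `∑ min 1 (a / σ)` over the reservoir does not change for any `σ ≥ τ`, and it always
equals `∑ min 1 (w i / σ)` over the whole stream seen so far.

For the running time, joining two trees costs a constant times the difference of their heights, so
the costs of the joins made by a split along a path telescope to the height.
-/

namespace VarOpt

/-! ### Lists cut at a boundary -/

section Lists

variable {α β : Type*} [Preorder β] {f : α → β} {l : List α} {c : β}

theorem le_of_getLast?_le (hl : l.Pairwise (f · ≤ f ·)) (h : ∀ a ∈ l.getLast?, f a ≤ c) :
    ∀ a ∈ l, f a ≤ c := by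
  induction l using List.reverseRecOn with
  | nil => simp
  | append_singleton l b _ =>
    have hb : f b ≤ c := h b (by simp)
    rw [List.pairwise_append] at hl
    intro a ha
    rcases List.mem_append.1 ha with ha | ha
    · exact (hl.2.2 a ha b (by simp)).trans hb
    · rwa [List.mem_singleton.1 ha]

theorem lt_of_lt_head? (hl : l.Pairwise (f · ≤ f ·)) (h : ∀ a ∈ l.head?, c < f a) :
    ∀ a ∈ l, c < f a := by
  cases l with
  | nil => simp
  | cons b l =>
    have hb : c < f b := h b rfl
    exact List.forall_mem_cons.2 ⟨hb, fun a ha => hb.trans_le ((List.pairwise_cons.1 hl).1 a ha)⟩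

theorem exists_append_of_append_eq {p : α → Prop} {A B A' B' : List α} (h : A ++ B = A' ++ B')
    (hA' : ∀ a ∈ A', p a) (hB : ∀ b ∈ B, ¬ p b) : ∃ C, A = A' ++ C ∧ B' = C ++ B := by
  rcases List.append_eq_append_iff.1 h with ⟨C, rfl, rfl⟩ | ⟨C, rfl, rfl⟩
  · cases C with
    | nil => exact ⟨[], by simp⟩
    | cons b C => exact absurd (hA' b (by simp)) (hB b (by simp))
  · exact ⟨C, rfl, rfl⟩

end Lists

/-! ### Threshold sampling -/

section Sampling

variable {ι : Type*} {k p : ℕ} {τ σ ρ : ℝ} {l U V : List (ι × ℝ)}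

/-- The total adjusted weight of a list of items with adjusted weights. -/
noncomputable def adjSum (l : List (ι × ℝ)) : ℝ := (l.map Prod.snd).sum

/-- The total amount by which the adjusted weights fall short of `τ`. Divided by `τ` it is the total
drop probability. -/
noncomputable def gap (τ : ℝ) (l : List (ι × ℝ)) : ℝ := (l.map fun q => τ - q.2).sum

/-- The quantity `∑ min 1 (a / σ)` over the adjusted weights `a`, which the threshold brings to the
capacity of the reservoir. -/
noncomputable def minSum (σ : ℝ) (l : List (ι × ℝ)) : ℝ := (l.map fun q => min 1 (q.2 / σ)).sum

@[simp] theorem adjSum_nil : adjSum ([] : List (ι × ℝ)) = 0 := rfl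

@[simp] theorem adjSum_cons (q : ι × ℝ) (l) : adjSum (q :: l) = q.2 + adjSum l := by simp [adjSum]

@[simp] theorem adjSum_append (l l' : List (ι × ℝ)) :
    adjSum (l ++ l') = adjSum l + adjSum l' := by simp [adjSum]

theorem adjSum_pos (h : ∀ q ∈ l, 0 < q.2) (hne : l ≠ []) : 0 < adjSum l :=
  List.sum_pos _ (List.forall_mem_map.2 h) (by simpa using hne)

@[simp] theorem gap_nil : gap τ ([] : List (ι × ℝ)) = 0 := rfl

@[simp] theorem gap_cons (q : ι × ℝ) (l) : gap τ (q :: l) = τ - q.2 + gap τ l := by simp [gap]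

@[simp] theorem gap_append (l l' : List (ι × ℝ)) : gap τ (l ++ l') = gap τ l + gap τ l' := by
  simp [gap]

@[simp] theorem minSum_cons (q : ι × ℝ) (l) :
    minSum σ (q :: l) = min 1 (q.2 / σ) + minSum σ l := by simp [minSum]

@[simp] theorem minSum_append (l l' : List (ι × ℝ)) :
    minSum σ (l ++ l') = minSum σ l + minSum σ l' := by simp [minSum]

theorem minSum_perm {l' : List (ι × ℝ)} (h : l.Perm l') : minSum σ l = minSum σ l' :=
  (h.map _).sum_eq

theorem gap_eq_length_mul_sub (τ : ℝ) (l : List (ι × ℝ)) : gap τ l = l.length * τ - adjSum l := by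
  induction l with
  | nil => simp
  | cons q l ih => rw [gap_cons, adjSum_cons, ih, List.length_cons]; push_cast; ring

theorem gap_nonneg (h : ∀ q ∈ l, q.2 ≤ τ) : 0 ≤ gap τ l :=
  List.sum_nonneg (List.forall_mem_map.2 fun q hq => sub_nonneg.2 (h q hq))

theorem gap_take_mono (h : ∀ q ∈ l, q.2 ≤ τ) : Monotone fun n => gap τ (l.take n) := by
  refine monotone_nat_of_le_succ fun n => ?_
  simp only [List.take_add, gap_append, le_add_iff_nonneg_right]
  exact gap_nonneg fun q hq => h q (List.mem_of_mem_drop (List.mem_of_mem_take hq))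

theorem gap_take_succ {i : ℕ} (hi : i < l.length) :
    gap τ (l.take (i + 1)) = gap τ (l.take i) + (τ - l[i].2) := by
  rw [← List.take_concat_get' l i hi, gap_append, gap_cons, gap_nil, add_zero]

theorem gap_div_eq_sum (hτ : τ ≠ 0) (l : List (ι × ℝ)) :
    (l.map fun q => 1 - q.2 / τ).sum = gap τ l / τ := by
  rw [gap, div_eq_mul_inv, ← List.sum_map_mul_right]
  exact congrArg List.sum (List.map_congr_left fun q _ => by field_simp)

theorem minSum_of_le (hσ : 0 < σ) (h : ∀ q ∈ l, q.2 ≤ σ) : minSum σ l = adjSum l / σ := by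
  rw [minSum, adjSum, div_eq_mul_inv, ← List.sum_map_mul_right]
  exact congrArg List.sum (List.map_congr_left fun q hq =>
    min_eq_right ((div_le_one hσ).2 (h q hq)))

theorem minSum_of_ge (hσ : 0 < σ) (h : ∀ q ∈ l, σ ≤ q.2) : minSum σ l = l.length := by
  have hone : l.map (fun q => min 1 (q.2 / σ)) = l.map fun _ => 1 :=
    List.map_congr_left fun q hq => min_eq_left ((one_le_div hσ).2 (h q hq))
  simp [minSum, hone]

/-- The list `U ++ V` of `k + 1` items in nondecreasing order of adjusted weight, cut at the
threshold `τ` of the round. The equation `∑ min 1 (a / τ) = k` for the threshold is encoded as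
`gap_eq`. -/
structure Cut (k : ℕ) (τ : ℝ) (U V : List (ι × ℝ)) : Prop where
  thr_pos : 0 < τ
  pos : ∀ q ∈ U ++ V, 0 < q.2
  sorted : (U ++ V).Pairwise (·.2 ≤ ·.2)
  card : U.length + V.length = k + 1
  le : ∀ q ∈ U, q.2 ≤ τ
  lt : ∀ q ∈ V, τ < q.2
  gap_eq : gap τ U = τ

theorem Cut.of_boundary (hk : 1 ≤ k) (hpos : ∀ q ∈ U ++ V, 0 < q.2)
    (hsorted : (U ++ V).Pairwise (·.2 ≤ ·.2)) (hcard : U.length + V.length = k + 1)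
    (hU : ∀ u ∈ U.getLast?, ((U.length - 1 : ℕ) : ℝ) * u.2 ≤ adjSum U)
    (hV : ∀ v ∈ V.head?, adjSum U + v.2 < U.length * v.2) :
    Cut k (adjSum U / ((U.length - 1 : ℕ) : ℝ)) U V := by
  have hposU : ∀ q ∈ U, 0 < q.2 := fun q hq => hpos q (List.mem_append_left _ hq)
  have htwo : 2 ≤ U.length := by
    by_contra! hlt
    obtain ⟨v, V', rfl⟩ := List.exists_cons_of_length_pos (l := V) (by omega)
    have hv : 0 < v.2 := hpos v (by simp)
    have hle : (U.length : ℝ) ≤ 1 := by exact_mod_cast Nat.le_of_lt_succ hlt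
    have hsum : 0 ≤ adjSum U := List.sum_nonneg (List.forall_mem_map.2 fun q hq => (hposU q hq).le)
    nlinarith [hV v rfl]
  obtain ⟨n, hn⟩ : ∃ n, U.length = n + 1 := ⟨U.length - 1, by omega⟩
  have hn0 : (0 : ℝ) < n := by exact_mod_cast (by omega : 0 < n)
  have hsum : 0 < adjSum U := adjSum_pos hposU (List.ne_nil_of_length_eq_add_one hn)
  simp only [hn, Nat.add_sub_cancel, Nat.cast_add, Nat.cast_one] at hU hV ⊢
  have hsplit := List.pairwise_append.1 hsorted
  refine ⟨by positivity, hpos, hsorted, hcard, ?_, ?_, ?_⟩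
  · refine le_of_getLast?_le hsplit.1 fun u hu => ?_
    rw [le_div_iff₀ hn0]
    linarith [hU u hu]
  · refine lt_of_lt_head? hsplit.2.1 fun v hv => ?_
    rw [div_lt_iff₀ hn0]
    linarith [hV v hv]
  · rw [gap_eq_length_mul_sub, hn]
    push_cast
    field_simp
    ring

/-- The reservoir after a round which drops the item at position `p` of `U`. -/
def rest (τ : ℝ) (U V : List (ι × ℝ)) (p : ℕ) : List (ι × ℝ) :=
  (U.eraseIdx p).map (fun q => (q.1, τ)) ++ V

theorem map_fst_rest (hp : p < U.length) :
    (rest τ U V p).map Prod.fst = ((U ++ V).map Prod.fst).eraseIdx p := by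
  rw [rest, List.map_append, List.map_append, List.map_map,
    List.eraseIdx_append_of_lt_length (by simpa using hp), List.eraseIdx_map]
  rfl

namespace Cut

theorem adjSum_eq (h : Cut k τ U V) : adjSum U = (U.length - 1) * τ := by
  linarith [h.gap_eq, gap_eq_length_mul_sub τ U]

theorem two_le_length (h : Cut k τ U V) : 2 ≤ U.length := by
  have hne : U ≠ [] := by
    rintro rfl
    exact h.thr_pos.ne' h.gap_eq.symm
  have hsum : 0 < adjSum U := adjSum_pos (fun q hq => h.pos q (List.mem_append_left _ hq)) hne
  rw [h.adjSum_eq, mul_pos_iff_of_pos_right h.thr_pos, sub_pos] at hsum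
  exact_mod_cast hsum

theorem minSum_eq (h : Cut k τ U V) : minSum τ (U ++ V) = k := by
  have hcard : (U.length : ℝ) + V.length = k + 1 := by exact_mod_cast h.card
  rw [minSum_append, minSum_of_le h.thr_pos h.le,
    minSum_of_ge h.thr_pos fun q hq => (h.lt q hq).le, h.adjSum_eq,
    mul_div_cancel_right₀ _ h.thr_pos.ne']
  linarith

theorem minSum_rest (h : Cut k τ U V) (hσ : τ ≤ σ) (hp : p < U.length) :
    minSum σ (rest τ U V p) = minSum σ (U ++ V) := by
  have hσ0 : 0 < σ := h.thr_pos.trans_le hσ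
  have hsum : adjSum ((U.eraseIdx p).map fun q => (q.1, τ)) = adjSum U := by
    rw [h.adjSum_eq]
    simp [adjSum, Function.comp_def, List.length_eraseIdx_of_lt hp,
      Nat.cast_sub (by omega : 1 ≤ U.length)]
  rw [rest, minSum_append, minSum_append, minSum_of_le hσ0 (List.forall_mem_map.2 fun _ _ => hσ),
    minSum_of_le hσ0 fun q hq => (h.le q hq).trans hσ, hsum]

end Cut

/-- The gaps of the items of `U`, added up from the left, first reach `ρ` at position `p`. As the
gaps are nonnegative whenever this notion is used, only the two partial sums around `p` are
compared with `ρ`. -/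
structure CrossesAt (τ ρ : ℝ) (U : List (ι × ℝ)) (p : ℕ) : Prop where
  lt_length : p < U.length
  lt : gap τ (U.take p) < ρ
  le : ρ ≤ gap τ (U.take (p + 1))

namespace CrossesAt

theorem of_boundary {P A B : List (ι × ℝ)} (hP : gap τ P < ρ)
    (hA : ∀ a ∈ A.getLast?, gap τ (P ++ A) < ρ) (hB : ∀ b ∈ B.head?, ρ ≤ gap τ (P ++ A ++ [b]))
    (h : ρ ≤ gap τ (P ++ A ++ B)) : CrossesAt τ ρ (P ++ A ++ B) (P ++ A).length := by
  have hPA : gap τ (P ++ A) < ρ := by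
    cases A using List.reverseRecOn with
    | nil => simpa using hP
    | append_singleton A a => exact hA a (by simp)
  cases B with
  | nil => exact absurd (h.trans_eq (by simp)) hPA.not_ge
  | cons b B => exact ⟨by simp, by rwa [List.take_left], by
      rw [List.append_cons, List.take_left' (by simp [add_assoc])]
      exact hB b rfl⟩

theorem append_right {P : List (ι × ℝ)} (h : CrossesAt τ ρ P p) (Q : List (ι × ℝ)) :
    CrossesAt τ ρ (P ++ Q) p where
  lt_length := by simpa using Nat.lt_add_right _ h.lt_length
  lt := by simpa [List.take_append_of_le_length h.lt_length.le] using h.lt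
  le := by simpa [List.take_append_of_le_length h.lt_length] using h.le

theorem unique {p' : ℕ} (hU : ∀ q ∈ U, q.2 ≤ τ) (h : CrossesAt τ ρ U p)
    (h' : CrossesAt τ ρ U p') : p = p' :=
  le_antisymm
    (Nat.lt_succ_iff.1 ((gap_take_mono hU).reflect_lt (h.lt.trans_le h'.le)))
    (Nat.lt_succ_iff.1 ((gap_take_mono hU).reflect_lt (h'.lt.trans_le h.le)))

end CrossesAt

theorem Cut.isRound {U V pre post : List (ℕ × ℝ)} {r : ℝ} (h : Cut k τ U V)
    (hp : CrossesAt τ (r * τ) U p) (hpre : (U ++ V).Perm pre) (hpost : post.Perm (rest τ U V p)) :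
    IsRound k pre r τ post := by
  have htake {n : ℕ} (hn : n ≤ p + 1) : (U ++ V).take n = U.take n :=
    List.take_append_of_le_length (hn.trans hp.lt_length)
  refine ⟨h.thr_pos, (minSum_perm hpre).symm.trans h.minSum_eq, U ++ V, hpre, h.sorted, p,
    by simpa using Nat.lt_add_right _ hp.lt_length, ?_, ?_, fun e he => ?_, hpost.trans ?_⟩
  · rw [List.getElem_append_left hp.lt_length]
    exact h.le _ (List.getElem_mem _)
  · rw [gap_div_eq_sum h.thr_pos.ne', le_div_iff₀ h.thr_pos, htake le_rfl]
    exact hp.le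
  · rw [gap_div_eq_sum h.thr_pos.ne', div_lt_iff₀ h.thr_pos, htake (by omega)]
    exact (gap_take_mono h.le he).trans_lt hp.lt
  · have hU : (U.eraseIdx p).map (fun q => (q.1, max q.2 τ))
        = (U.eraseIdx p).map fun q => (q.1, τ) :=
      List.map_congr_left fun q hq => by rw [max_eq_right (h.le q (List.mem_of_mem_eraseIdx hq))]
    have hV : V.map (fun q => (q.1, max q.2 τ)) = V :=
      (List.map_congr_left fun q hq => by simp [(h.lt q hq).le]).trans (List.map_id V)
    rw [List.eraseIdx_append_of_lt_length hp.lt_length, List.map_append, hU, hV, rest]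

theorem fst_notMem_rest_iff (hnodup : ((U ++ V).map Prod.fst).Nodup) (hp : p < U.length) {i : ℕ}
    (hi : i < (U ++ V).length) :
    (U ++ V)[i].1 ∉ (rest τ U V p).map Prod.fst ↔ i = p := by
  have hget : (U ++ V)[i].1 = ((U ++ V).map Prod.fst)[i]'(by simpa using hi) := by
    rw [List.getElem_map]
  rw [map_fst_rest hp, hget, List.mem_eraseIdx_iff_getElem]
  simp only [not_exists, not_and, hnodup.getElem_inj_iff]
  exact ⟨fun hne => by_contra fun hip => hne i (by simpa using hi) hip rfl,
    fun hip j _ hjp hji => hjp (hji.trans hip)⟩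

theorem volume_Ioo_zero_one_inter_Ioc {a b : ℝ} (ha : 0 ≤ a) (hb : b ≤ 1) :
    volume (Set.Ioo 0 1 ∩ Set.Ioc a b) = ENNReal.ofReal (b - a) := by
  have hae : (Set.Ioo 0 1 ∩ Set.Ioc a b : Set ℝ) =ᵐ[volume] (Set.Ioc 0 1 ∩ Set.Ioc a b : Set ℝ) :=
    Ioo_ae_eq_Ioc.inter (ae_eq_refl _)
  rw [measure_congr hae, Set.Ioc_inter_Ioc, Real.volume_Ioc, sup_eq_right.2 ha, inf_eq_right.2 hb]

theorem Cut.volume_dropped (h : Cut k τ U V) (hnodup : ((U ++ V).map Prod.fst).Nodup)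
    {drop : ℝ → ℕ} (hdrop : ∀ ρ ∈ Set.Ioo (0 : ℝ) 1, CrossesAt τ (ρ * τ) U (drop ρ))
    {q : ι × ℝ} (hq : q ∈ U ++ V) :
    volume {ρ : ℝ | ρ ∈ Set.Ioo (0 : ℝ) 1 ∧ q.1 ∉ (rest τ U V (drop ρ)).map Prod.fst}
      = ENNReal.ofReal (1 - min 1 (q.2 / τ)) := by
  obtain ⟨i, hi, rfl⟩ := List.getElem_of_mem hq
  have hset : {ρ : ℝ | ρ ∈ Set.Ioo (0 : ℝ) 1 ∧ (U ++ V)[i].1 ∉ (rest τ U V (drop ρ)).map Prod.fst}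
      = {ρ | ρ ∈ Set.Ioo (0 : ℝ) 1 ∧ i = drop ρ} :=
    Set.ext fun ρ => and_congr_right fun hρ =>
      fst_notMem_rest_iff hnodup (hdrop ρ hρ).lt_length hi
  rw [hset]
  rcases lt_or_ge i U.length with hiU | hiU
  · have hcross : {ρ | ρ ∈ Set.Ioo (0 : ℝ) 1 ∧ i = drop ρ}
        = Set.Ioo 0 1 ∩ Set.Ioc (gap τ (U.take i) / τ) (gap τ (U.take (i + 1)) / τ) := by
      ext ρ
      refine and_congr_right fun hρ => ?_
      rw [Set.mem_Ioc, div_lt_iff₀ h.thr_pos, le_div_iff₀ h.thr_pos]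
      constructor
      · rintro rfl
        exact ⟨(hdrop ρ hρ).lt, (hdrop ρ hρ).le⟩
      · exact fun hmem => CrossesAt.unique h.le ⟨hiU, hmem.1, hmem.2⟩ (hdrop ρ hρ)
    have hle : (U ++ V)[i].2 ≤ τ := by
      rw [List.getElem_append_left hiU]
      exact h.le _ (List.getElem_mem _)
    have hone : gap τ (U.take (i + 1)) ≤ τ := by
      simpa [h.gap_eq] using gap_take_mono h.le (show i + 1 ≤ U.length from hiU)
    rw [hcross, volume_Ioo_zero_one_inter_Ioc
      (div_nonneg (gap_nonneg fun q hq => h.le q (List.mem_of_mem_take hq)) h.thr_pos.le)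
      ((div_le_one h.thr_pos).2 hone), gap_take_succ hiU,
      min_eq_right ((div_le_one h.thr_pos).2 hle), List.getElem_append_left hiU, ← sub_div,
      add_sub_cancel_left, sub_div, div_self h.thr_pos.ne']
  · have hempty : {ρ | ρ ∈ Set.Ioo (0 : ℝ) 1 ∧ i = drop ρ} = ∅ :=
      Set.eq_empty_of_forall_notMem fun ρ hρ => (hdrop ρ hρ.1).lt_length.not_ge (hρ.2 ▸ hiU)
    have hlt : τ < (U ++ V)[i].2 := by
      rw [List.getElem_append_right hiU]
      exact h.lt _ (List.getElem_mem _)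
    rw [hempty, measure_empty, min_eq_left ((one_le_div h.thr_pos).2 hlt.le)]
    simp

end Sampling

/-! ### Values and costs of programs -/

namespace Timed

variable {α β : Type}

@[simp] theorem val_pure (a : α) : (pure a : Timed α).val = a := rfl

@[simp] theorem time_pure (a : α) : (pure a : Timed α).time = 0 := rfl

@[simp] theorem val_bind (m : Timed α) (f : α → Timed β) : (m >>= f).val = (f m.val).val := rfl

@[simp] theorem time_bind (m : Timed α) (f : α → Timed β) :
    (m >>= f).time = m.time + (f m.val).time := rfl

@[simp] theorem val_map (f : α → β) (m : Timed α) : (f <$> m).val = f m.val := rfl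

@[simp] theorem time_map (f : α → β) (m : Timed α) : (f <$> m).time = m.time := rfl

@[simp] theorem val_ite (c : Prop) [Decidable c] (m m' : Timed α) :
    (if c then m else m').val = if c then m.val else m'.val := apply_ite ..

@[simp] theorem time_ite (c : Prop) [Decidable c] (m m' : Timed α) :
    (if c then m else m').time = if c then m.time else m'.time := apply_ite ..

end Timed

@[simp] theorem val_step {α : Type} (a : α) : (step a).val = a := rfl

@[simp] theorem time_step {α : Type} (a : α) : (step a).time = 1 := rfl

attribute [ext] Timed

attribute [simp] radd rsub rmul rdiv nadd nsub nmax toReal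

@[simp] theorem val_rle {a b : ℝ} : (rle a b).val = true ↔ a ≤ b := decide_eq_true_iff

@[simp] theorem val_rlt {a b : ℝ} : (rlt a b).val = true ↔ a < b := decide_eq_true_iff

@[simp] theorem val_nle {a b : ℕ} : (nle a b).val = true ↔ a ≤ b := decide_eq_true_iff

@[simp] theorem val_nlt {a b : ℕ} : (nlt a b).val = true ↔ a < b := decide_eq_true_iff

@[simp] theorem time_rle (a b : ℝ) : (rle a b).time = 1 := rfl

@[simp] theorem time_rlt (a b : ℝ) : (rlt a b).time = 1 := rfl

@[simp] theorem time_nle (a b : ℕ) : (nle a b).time = 1 := rfl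

@[simp] theorem time_nlt (a b : ℕ) : (nlt a b).time = 1 := rfl

/-! ### Trees -/

/-- The total original weight of a list of items. -/
noncomputable def weight (l : List Item) : ℝ := (l.map Item.w).sum

@[simp] theorem weight_nil : weight [] = 0 := rfl

@[simp] theorem weight_cons (x : Item) (l) : weight (x :: l) = x.w + weight l := by simp [weight]

@[simp] theorem weight_append (l l' : List Item) : weight (l ++ l') = weight l + weight l' := by
  simp [weight]

namespace Tree

variable {l r t : Tree} {x : Item} {h n : ℕ} {s : ℝ}

@[simp] theorem toList_nil : nil.toList = [] := rfl

@[simp] theorem toList_node : (node l x r h n s).toList = l.toList ++ x :: r.toList := rfl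

@[simp] theorem depth_nil : nil.depth = 0 := rfl

@[simp] theorem depth_node : (node l x r h n s).depth = max l.depth r.depth + 1 := rfl

@[simp] theorem time_height (t : Tree) : t.height.time = 1 := by cases t <;> rfl

@[simp] theorem time_size (t : Tree) : t.size.time = 1 := by cases t <;> rfl

@[simp] theorem time_total (t : Tree) : t.total.time = 1 := by cases t <;> rfl

/-- The invariant of every tree in the implementation: it is height-balanced and its stored fields
are correct. -/
structure WellFormed (t : Tree) : Prop where
  balanced : t.Balanced
  augmented : t.Augmented

theorem wellFormed_nil : nil.WellFormed := ⟨trivial, trivial⟩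

namespace WellFormed

theorem left (ht : (node l x r h n s).WellFormed) : l.WellFormed :=
  ⟨ht.balanced.2.2.1, ht.augmented.2.2.2.1⟩

theorem right (ht : (node l x r h n s).WellFormed) : r.WellFormed :=
  ⟨ht.balanced.2.2.2, ht.augmented.2.2.2.2⟩

theorem left_le (ht : (node l x r h n s).WellFormed) : l.depth ≤ r.depth + 1 := ht.balanced.1

theorem right_le (ht : (node l x r h n s).WellFormed) : r.depth ≤ l.depth + 1 := ht.balanced.2.1

theorem val_height (ht : t.WellFormed) : t.height.val = t.depth := by
  cases t with
  | nil => rfl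
  | node => exact ht.augmented.1

theorem val_size (ht : t.WellFormed) : t.size.val = t.toList.length := by
  cases t with
  | nil => rfl
  | node => exact ht.augmented.2.1

theorem val_total (ht : t.WellFormed) : t.total.val = weight t.toList := by
  cases t with
  | nil => rfl
  | node => exact ht.augmented.2.2.1

end WellFormed

open Real in
theorem goldenRatio_pow_depth_le (ht : t.Balanced) :
    goldenRatio ^ t.depth ≤ t.toList.length + 1 := by
  induction t with
  | nil => simp
  | node l x r h n s ihl ihr =>
    have add_of_le {a b : ℝ} {d e : ℕ} (ha : goldenRatio ^ d ≤ a) (hb : goldenRatio ^ e ≤ b)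
        (hde : d ≤ e + 1) : goldenRatio ^ (d + 1) ≤ a + b := by
      have hφ : 0 < goldenRatio - 1 := sub_pos.2 one_lt_goldenRatio
      have hpow : goldenRatio ^ d ≤ goldenRatio ^ (e + 1) :=
        pow_le_pow_right₀ one_lt_goldenRatio.le hde
      calc goldenRatio ^ (d + 1) = goldenRatio ^ d + goldenRatio ^ d * (goldenRatio - 1) := by ring
        _ ≤ goldenRatio ^ d + goldenRatio ^ (e + 1) * (goldenRatio - 1) := by gcongr
        _ = goldenRatio ^ d + goldenRatio ^ e * (goldenRatio ^ 2 - goldenRatio) := by ring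
        _ = goldenRatio ^ d + goldenRatio ^ e := by rw [goldenRatio_sq]; ring
        _ ≤ a + b := add_le_add ha hb
    obtain ⟨hlr, hrl, hl, hr⟩ := ht
    have hlen : ((node l x r h n s).toList.length : ℝ) + 1
        = (l.toList.length + 1) + (r.toList.length + 1) := by
      simp only [toList_node, List.length_append, List.length_cons]
      push_cast
      ring
    rw [hlen, depth_node]
    rcases le_total r.depth l.depth with hle | hle
    · rw [max_eq_left hle]
      exact add_of_le (ihl hl) (ihr hr) hlr
    · rw [max_eq_right hle, add_comm (_ + 1 : ℝ)]
      exact add_of_le (ihr hr) (ihl hl) hrl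

theorem depth_le_log (ht : t.Balanced) :
    (t.depth : ℝ) ≤ Real.log (t.toList.length + 1) / Real.log Real.goldenRatio := by
  rw [le_div_iff₀ (Real.log_pos Real.one_lt_goldenRatio), ← Real.log_pow]
  exact Real.log_le_log (pow_pos Real.goldenRatio_pos _) (goldenRatio_pow_depth_le ht)

/-! ### Mirror images -/

/-- The mirror image of a tree. It turns left rotations and joins along the right spine into right
rotations and joins along the left spine, so that only the former have to be analysed. -/
def mirror : Tree → Tree
  | nil => nil
  | node l x r h n s => node r.mirror x l.mirror h n s

@[simp] theorem mirror_mirror (t : Tree) : t.mirror.mirror = t := by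
  induction t with
  | nil => rfl
  | node l x r h n s ihl ihr => simp [mirror, ihl, ihr]

@[simp] theorem toList_mirror (t : Tree) : t.mirror.toList = t.toList.reverse := by
  induction t with
  | nil => rfl
  | node l x r h n s ihl ihr => simp [mirror, ihl, ihr]

@[simp] theorem depth_mirror (t : Tree) : t.mirror.depth = t.depth := by
  induction t with
  | nil => rfl
  | node l x r h n s ihl ihr => simp [mirror, ihl, ihr, max_comm]

@[simp] theorem height_mirror (t : Tree) : t.mirror.height = t.height := by cases t <;> rfl

@[simp] theorem size_mirror (t : Tree) : t.mirror.size = t.size := by cases t <;> rfl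

@[simp] theorem total_mirror (t : Tree) : t.mirror.total = t.total := by cases t <;> rfl

theorem Balanced.mirror (ht : t.Balanced) : t.mirror.Balanced := by
  induction t with
  | nil => trivial
  | node l x r h n s ihl ihr =>
    obtain ⟨hlr, hrl, hl, hr⟩ := ht
    exact ⟨by simpa using hrl, by simpa using hlr, ihr hr, ihl hl⟩

theorem Augmented.mirror (ht : t.Augmented) : t.mirror.Augmented := by
  induction t with
  | nil => trivial
  | node l x r h n s ihl ihr =>
    obtain ⟨hh, hn, hs, hl, hr⟩ := ht
    change _ = (node l x r h n s).mirror.depth ∧ _ = (node l x r h n s).mirror.toList.length ∧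
      _ = ((node l x r h n s).mirror.toList.map Item.w).sum ∧ _
    rw [depth_mirror, toList_mirror, List.length_reverse, List.map_reverse, List.sum_reverse]
    exact ⟨hh, hn, hs, ihr hr, ihl hl⟩

theorem WellFormed.mirror (ht : t.WellFormed) : t.mirror.WellFormed :=
  ⟨ht.balanced.mirror, ht.augmented.mirror⟩

/-! ### Rebalancing and joining -/

@[simp] theorem depth_mk (l : Tree) (x : Item) (r : Tree) :
    (mk l x r).val.depth = max l.depth r.depth + 1 := rfl

@[simp] theorem toList_mk (l : Tree) (x : Item) (r : Tree) :
    (mk l x r).val.toList = l.toList ++ x :: r.toList := rfl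

@[simp] theorem time_mk (l : Tree) (x : Item) (r : Tree) : (mk l x r).time = 13 := by simp [mk]

theorem wellFormed_mk (hl : l.WellFormed) (x : Item) (hr : r.WellFormed)
    (hlr : l.depth ≤ r.depth + 1) (hrl : r.depth ≤ l.depth + 1) :
    (mk l x r).val.WellFormed := by
  refine ⟨⟨hlr, hrl, hl.balanced, hr.balanced⟩, ?_, ?_, ?_, hl.augmented, hr.augmented⟩
  · simp [hl.val_height, hr.val_height]
  · simp [hl.val_size, hr.val_size, add_assoc]
  · simp [hl.val_total, hr.val_total, weight]
    ring

theorem mirror_mk (l : Tree) (x : Item) (r : Tree) :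
    (mk l x r).val.mirror = (mk r.mirror x l.mirror).val := by
  simp [mk, mirror, max_comm, add_comm]

theorem balL_eq_mirror (t : Tree) (y : Item) (r : Tree) :
    balL t y r = mirror <$> balR r.mirror y t.mirror := by
  rcases t with _ | ⟨a, z, b⟩
  · ext1 <;> simp [balL, balR, mirror, mirror_mk]
  · rcases b with _ | ⟨b₁, v, b₂⟩ <;> ext1 <;>
      simp only [balL, balR, mirror, Timed.val_bind, Timed.time_bind, Timed.val_map,
        Timed.time_map, Timed.val_ite, Timed.time_ite, apply_ite Tree.mirror, mirror_mk,
        height_mirror, mirror_mirror, time_height, time_mk, time_nle, nadd] <;> rfl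

@[simp] theorem toList_balR (l : Tree) (y : Item) (t : Tree) :
    (balR l y t).val.toList = l.toList ++ y :: t.toList := by
  unfold balR
  simp only [Timed.val_bind, Timed.val_ite]
  split_ifs
  · rfl
  · rcases t with _ | ⟨a, z, b⟩
    · rfl
    · simp only [Timed.val_bind, Timed.val_ite]
      split_ifs
      · simp
      · cases a <;> simp

theorem time_balR_le (l : Tree) (y : Item) (t : Tree) : (balR l y t).time ≤ 46 := by
  unfold balR
  simp only [Timed.time_bind, Timed.time_ite, nadd, time_nle, time_step, time_height]
  split_ifs
  · simp
  · rcases t with _ | ⟨a, z, b⟩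
    · simp
    · simp only [Timed.time_bind, Timed.time_ite, time_nle, time_height, time_mk]
      split_ifs
      · simp
      · cases a <;> simp

theorem balR_wellFormed (hl : l.WellFormed) (y : Item) (ht : t.WellFormed)
    (hlt : l.depth ≤ t.depth + 1) (htl : t.depth ≤ l.depth + 2) :
    (balR l y t).val.WellFormed ∧
      (balR l y t).val.depth ∈ Set.Icc (max l.depth t.depth) (max l.depth t.depth + 1) ∧
      (t.depth ≤ l.depth + 1 → (balR l y t).val.depth = max l.depth t.depth + 1) := by
  unfold balR
  simp only [Timed.val_bind, Timed.val_ite, nadd, val_step, val_nle, hl.val_height,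
    ht.val_height, Set.mem_Icc]
  split_ifs with hbal
  · exact ⟨wellFormed_mk hl y ht hlt hbal, by simp, by simp⟩
  · rcases t with _ | ⟨a, z, b⟩
    · simp at hbal
    · have hab := ht.left_le
      have hba := ht.right_le
      simp only [Timed.val_bind, Timed.val_ite, val_nle, ht.left.val_height,
        ht.right.val_height]
      simp only [depth_node] at *
      split_ifs with hsingle
      · have hu := wellFormed_mk hl y ht.left (by omega) (by omega)
        exact ⟨wellFormed_mk hu z ht.right (by simp; omega) (by simp; omega), by simp; omega,
          by omega⟩
      · rcases a with _ | ⟨a₁, v, a₂⟩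
        · simp at hsingle
        · have ha := ht.left.left_le
          have ha' := ht.left.right_le
          simp only [depth_node] at *
          have hu₁ := wellFormed_mk hl y ht.left.left (by omega) (by omega)
          have hu₂ := wellFormed_mk ht.left.right z ht.right (by omega) (by omega)
          simp only [Timed.val_bind, depth_mk]
          exact ⟨wellFormed_mk hu₁ v hu₂ (by simp; omega) (by simp; omega), by omega, by omega⟩

@[simp] theorem toList_joinR (l : Tree) (x : Item) (r : Tree) :
    (joinR l x r).val.toList = l.toList ++ x :: r.toList := by
  induction l with
  | nil => rfl
  | node ll y lr h n s _ ih =>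
    simp only [joinR, Timed.val_bind, Timed.val_ite]
    split_ifs
    · rfl
    · simp [ih]

theorem joinR_wellFormed (hl : l.WellFormed) (x : Item) (hr : r.WellFormed)
    (hrl : r.depth ≤ l.depth) :
    (joinR l x r).val.WellFormed ∧ (joinR l x r).val.depth ∈ Set.Icc l.depth (l.depth + 1) := by
  induction l with
  | nil => exact ⟨wellFormed_mk hl x hr (by simp) (by simp at hrl; simp [hrl]), by simp_all [joinR]⟩
  | node ll y lr h n s _ ih =>
    have hlr := hl.left_le
    have hrl' := hl.right_le
    simp only [joinR, Timed.val_bind, Timed.val_ite, nadd, val_step, val_nle,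
      hl.val_height, hr.val_height, Set.mem_Icc]
    split_ifs with hbal
    · exact ⟨wellFormed_mk hl x hr hbal (by omega), by simp only [depth_mk]; omega⟩
    · simp only [depth_node] at *
      obtain ⟨ht, hle, hge⟩ := ih hl.right (by omega)
      obtain ⟨ht', ⟨hle', hge'⟩, heq⟩ := balR_wellFormed hl.left y ht (by omega) (by omega)
      exact ⟨ht', by omega, by omega⟩

theorem time_joinR_le (hl : l.WellFormed) (x : Item) (hr : r.WellFormed)
    (hrl : r.depth ≤ l.depth) : (joinR l x r).time + 50 * r.depth ≤ 50 * l.depth + 50 := by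
  induction l with
  | nil =>
    simp only [joinR, time_mk, depth_nil] at *
    omega
  | node ll y lr h n s _ ih =>
    have hlr := hl.left_le
    simp only [joinR, Timed.time_bind, Timed.time_ite, nadd, val_step, time_step,
      val_nle, time_nle, hl.val_height, hr.val_height, time_height, time_mk]
    split_ifs with hbal
    · omega
    · simp only [depth_node] at *
      have htime := ih hl.right (by omega)
      have hbalR := time_balR_le ll y (joinR lr x r).val
      omega

theorem joinL_eq_mirror (l : Tree) (x : Item) (r : Tree) :
    joinL l x r = mirror <$> joinR r.mirror x l.mirror := by
  induction r with
  | nil => ext1 <;> simp [joinL, joinR, mirror, mirror_mk]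
  | node rl y rr h n s ih _ =>
    ext1 <;>
      simp only [joinL, joinR, mirror, Timed.val_bind, Timed.time_bind, Timed.val_map,
        Timed.time_map, Timed.val_ite, Timed.time_ite, apply_ite Tree.mirror, mirror_mk,
        height_mirror, mirror_mirror, time_height, time_mk, nadd, time_nle, ih, balL_eq_mirror] <;>
      rfl

@[simp] theorem toList_join (l : Tree) (x : Item) (r : Tree) :
    (join l x r).val.toList = l.toList ++ x :: r.toList := by
  simp only [join, Timed.val_bind, Timed.val_ite]
  split_ifs <;> simp [joinL_eq_mirror]

theorem join_wellFormed (hl : l.WellFormed) (x : Item) (hr : r.WellFormed) :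
    (join l x r).val.WellFormed ∧
      (join l x r).val.depth ∈ Set.Icc (max l.depth r.depth) (max l.depth r.depth + 1) := by
  simp only [join, Timed.val_bind, Timed.val_ite, val_nle, hl.val_height, hr.val_height]
  split_ifs with hrl
  · simpa [max_eq_left hrl] using joinR_wellFormed hl x hr hrl
  · have hlr : l.depth ≤ r.depth := by omega
    obtain ⟨hwf, hdepth⟩ := joinR_wellFormed hr.mirror x hl.mirror (by simpa using hlr)
    simpa [joinL_eq_mirror, max_eq_right hlr] using And.intro hwf.mirror hdepth

theorem time_join_le (hl : l.WellFormed) (x : Item) (hr : r.WellFormed) :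
    (join l x r).time + 50 * min l.depth r.depth ≤ 50 * max l.depth r.depth + 53 := by
  simp only [join, Timed.time_bind, Timed.time_ite, val_nle, time_nle, hl.val_height,
    hr.val_height, time_height]
  split_ifs with hrl
  · have htime := time_joinR_le hl x hr hrl
    omega
  · have htime := time_joinR_le hr.mirror x hl.mirror (by simp only [depth_mirror]; omega)
    simp only [joinL_eq_mirror, Timed.time_map, depth_mirror] at htime ⊢
    omega

/-! ### Splitting, concatenation, insertion and deletion -/

theorem split_wellFormed (ht : t.WellFormed) (p : ℕ) :
    ((split t p).val.1.WellFormed ∧ (split t p).val.1.depth ≤ t.depth) ∧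
      (split t p).val.2.WellFormed ∧ (split t p).val.2.depth ≤ t.depth := by
  induction t generalizing p with
  | nil => exact ⟨⟨wellFormed_nil, le_rfl⟩, wellFormed_nil, le_rfl⟩
  | node l y r h n s ihl ihr =>
    simp only [split, Timed.val_bind, Timed.val_ite, depth_node]
    split_ifs
    · obtain ⟨⟨ha, hal⟩, hb, hbl⟩ := ihl ht.left p
      obtain ⟨hj, hjle, hjge⟩ := join_wellFormed hb y ht.right
      exact ⟨⟨ha, by simp only [Timed.val_pure]; omega⟩, hj, by simp only [Timed.val_pure]; omega⟩
    · obtain ⟨⟨ha, har⟩, hb, hbr⟩ := ihr ht.right _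
      obtain ⟨hj, hjle, hjge⟩ := join_wellFormed ht.left y ha
      exact ⟨⟨hj, by simp only [Timed.val_pure]; omega⟩, hb, by simp only [Timed.val_pure]; omega⟩

theorem time_split_le (ht : t.WellFormed) (p : ℕ) :
    (split t p).time
      ≤ 50 * ((split t p).val.1.depth + (split t p).val.2.depth) + 107 * t.depth + 1 := by
  induction t generalizing p with
  | nil => exact le_rfl
  | node l y r h n s ihl ihr =>
    have hlr := ht.left_le
    have hrl := ht.right_le
    simp only [split, Timed.val_bind, Timed.val_ite, Timed.time_bind, Timed.time_ite, nadd, nsub,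
      time_nle, time_step, time_size, Timed.time_pure, depth_node]
    split_ifs
    · obtain ⟨-, hb, hbl⟩ := split_wellFormed ht.left p
      obtain ⟨-, hjle, hjge⟩ := join_wellFormed hb y ht.right
      have htime := ihl ht.left p
      have hjoin := time_join_le hb y ht.right
      simp only [Timed.val_pure]
      omega
    · obtain ⟨⟨ha, har⟩, -⟩ :=
        split_wellFormed ht.right (step (p - (step (l.size.val + 1)).val)).val
      obtain ⟨-, hjle, hjge⟩ := join_wellFormed ht.left y ha
      have htime := ihr ht.right (step (p - (step (l.size.val + 1)).val)).val
      have hjoin := time_join_le ht.left y ha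
      simp only [Timed.val_pure]
      omega

theorem toList_split (ht : t.WellFormed) (p : ℕ) :
    (split t p).val.1.toList = t.toList.take p ∧ (split t p).val.2.toList = t.toList.drop p := by
  induction t generalizing p with
  | nil => simp [split]
  | node l y r h n s ihl ihr =>
    simp only [split, Timed.val_bind, Timed.val_ite, nadd, nsub, val_step, val_nle,
      ht.left.val_size, Timed.val_pure, toList_node]
    split_ifs with hp
    · simp [ihl ht.left p, List.take_append_of_le_length hp, List.drop_append_of_le_length hp]
    · obtain ⟨q, rfl⟩ : ∃ q, p = l.toList.length + 1 + q := ⟨p - (l.toList.length + 1), by omega⟩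
      rw [Nat.add_sub_cancel_left, Nat.add_assoc, List.take_length_add_append,
        List.drop_length_add_append, Nat.add_comm 1]
      simp [ihr ht.right q]

theorem cons_toList_popFirst (l : Tree) (x : Item) (r : Tree) :
    (popFirst l x r).val.1 :: (popFirst l x r).val.2.toList = l.toList ++ x :: r.toList := by
  induction l generalizing x r with
  | nil => rfl
  | node ll y lr h n s ih _ =>
    simp only [popFirst, Timed.val_bind, Timed.val_pure, toList_join, toList_node, ← ih]
    simp

theorem popFirst_wellFormed (ht : (node l x r h n s).WellFormed) :
    (popFirst l x r).val.2.WellFormed ∧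
      (popFirst l x r).val.2.depth ≤ (node l x r h n s).depth := by
  induction l generalizing x r h n s with
  | nil => exact ⟨ht.right, by simp [popFirst]⟩
  | node ll y lr h' n' s' ih _ =>
    have hrl := ht.right_le
    obtain ⟨hm, hmle⟩ := ih ht.left
    obtain ⟨hj, hjle, hjge⟩ := join_wellFormed hm x ht.right
    simp only [popFirst, Timed.val_bind, Timed.val_pure, depth_node] at *
    exact ⟨hj, by omega⟩

theorem time_popFirst_le (ht : (node l x r h n s).WellFormed) :
    (popFirst l x r).time
      ≤ 50 * (popFirst l x r).val.2.depth + 103 * (node l x r h n s).depth := by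
  induction l generalizing x r h n s with
  | nil => simp [popFirst]; omega
  | node ll y lr h' n' s' ih _ =>
    have hlr := ht.left_le
    have hrl := ht.right_le
    have htime := ih ht.left
    obtain ⟨hm, hmle⟩ := popFirst_wellFormed ht.left
    obtain ⟨-, hjle, hjge⟩ := join_wellFormed hm x ht.right
    have hjoin := time_join_le hm x ht.right
    simp only [popFirst, Timed.val_bind, Timed.time_bind, Timed.val_pure, Timed.time_pure,
      depth_node] at *
    omega

@[simp] theorem toList_concat (l r : Tree) : (concat l r).val.toList = l.toList ++ r.toList := by
  cases r with
  | nil => simp [concat]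
  | node => simp [concat, cons_toList_popFirst]

theorem concat_wellFormed (hl : l.WellFormed) (hr : r.WellFormed) :
    (concat l r).val.WellFormed ∧ (concat l r).val.depth ≤ max l.depth r.depth + 1 := by
  cases r with
  | nil => exact ⟨hl, by simp [concat]⟩
  | node rl y rr h n s =>
    obtain ⟨hm, hmle⟩ := popFirst_wellFormed hr
    obtain ⟨hj, -, hjge⟩ := join_wellFormed hl (popFirst rl y rr).val.1 hm
    exact ⟨hj, hjge.trans (by omega)⟩

theorem time_concat_le (hl : l.WellFormed) (hr : r.WellFormed) :
    (concat l r).time ≤ 203 * max l.depth r.depth + 53 := by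
  cases r with
  | nil => simp [concat]
  | node rl y rr h n s =>
    obtain ⟨hm, hmle⟩ := popFirst_wellFormed hr
    have hpop := time_popFirst_le hr
    have hjoin := time_join_le hl (popFirst rl y rr).val.1 hm
    simp only [concat, Timed.time_bind]
    omega

theorem toList_insertAt (ht : t.WellFormed) (p : ℕ) (x : Item) :
    (insertAt t p x).val.toList = t.toList.take p ++ x :: t.toList.drop p := by
  simp [insertAt, toList_split ht p]

theorem insertAt_wellFormed (ht : t.WellFormed) (p : ℕ) (x : Item) :
    (insertAt t p x).val.WellFormed ∧ (insertAt t p x).val.depth ≤ t.depth + 1 := by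
  obtain ⟨⟨ha, hale⟩, hb, hble⟩ := split_wellFormed ht p
  obtain ⟨hj, -, hjge⟩ := join_wellFormed ha x hb
  exact ⟨hj, hjge.trans (by omega)⟩

theorem time_insertAt_le (ht : t.WellFormed) (p : ℕ) (x : Item) :
    (insertAt t p x).time ≤ 257 * t.depth + 54 := by
  obtain ⟨⟨ha, hale⟩, hb, hble⟩ := split_wellFormed ht p
  have hsplit := time_split_le ht p
  have hjoin := time_join_le ha x hb
  simp only [insertAt, Timed.time_bind]
  omega

theorem toList_deleteAt (ht : t.WellFormed) (p : ℕ) :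
    (deleteAt t p).val.toList = t.toList.eraseIdx p := by
  obtain ⟨hfst, hsnd⟩ := toList_split ht p
  rw [List.eraseIdx_eq_take_drop_succ, ← hfst, ← List.drop_drop, ← hsnd]
  simp only [deleteAt, Timed.val_bind]
  cases (split t p).val.2 with
  | nil => simp
  | node l x r => simp [← cons_toList_popFirst l x r]

theorem deleteAt_wellFormed (ht : t.WellFormed) (p : ℕ) :
    (deleteAt t p).val.WellFormed ∧ (deleteAt t p).val.depth ≤ t.depth + 1 := by
  obtain ⟨⟨ha, hale⟩, hb, hble⟩ := split_wellFormed ht p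
  simp only [deleteAt, Timed.val_bind]
  generalize (split t p).val.2 = b at *
  cases b with
  | nil => exact ⟨ha, Nat.le_succ_of_le hale⟩
  | node l x r h n s =>
    obtain ⟨hm, hmle⟩ := popFirst_wellFormed hb
    obtain ⟨hc, hcle⟩ := concat_wellFormed ha hm
    exact ⟨hc, hcle.trans (by omega)⟩

theorem time_deleteAt_le (ht : t.WellFormed) (p : ℕ) :
    (deleteAt t p).time ≤ 563 * t.depth + 54 := by
  obtain ⟨⟨ha, hale⟩, hb, hble⟩ := split_wellFormed ht p
  have hsplit := time_split_le ht p
  simp only [deleteAt, Timed.time_bind]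
  generalize (split t p).val.2 = b at *
  cases b with
  | nil => simp only [time_step]; omega
  | node l x r h n s =>
    obtain ⟨hm, hmle⟩ := popFirst_wellFormed hb
    have hpop := time_popFirst_le hb
    have hconcat := time_concat_le ha hm
    simp only [Timed.time_bind]
    omega

/-! ### Searching -/

/-- The outcome of a search started with counters `c` and `s`: the items of the list in front of
`res` and behind it meet at a boundary, the last item `x` in front passing the test and the first
one behind failing it. -/
def SearchOutcome (pass : ℕ → ℝ → ℝ → Prop) (l : List Item) (c : ℕ) (s : ℝ) (res : ℕ × ℝ) : Prop :=
  ∃ A B, l = A ++ B ∧ res = (c + A.length, s + weight A) ∧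
    (∀ x ∈ A.getLast?, pass (c + A.length) (s + weight A) x.w) ∧
    ∀ x ∈ B.head?, ¬ pass (c + A.length + 1) (s + weight A + x.w) x.w

theorem searchOutcome_append_right {pass : ℕ → ℝ → ℝ → Prop} {l : List Item} {c : ℕ} {res : ℕ × ℝ}
    (h : SearchOutcome pass l c s res) {y : Item} (l' : List Item)
    (hy : ¬ pass (c + l.length + 1) (s + weight l + y.w) y.w) :
    SearchOutcome pass (l ++ y :: l') c s res := by
  obtain ⟨A, B, rfl, hres, hA, hB⟩ := h
  refine ⟨A, B ++ y :: l', List.append_assoc .., hres, hA, fun x hx => ?_⟩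
  cases B with
  | nil =>
    obtain rfl : y = x := by simpa using hx
    simpa using hy
  | cons z B => exact hB x hx

theorem searchOutcome_append_left {pass : ℕ → ℝ → ℝ → Prop} {l' : List Item} {c : ℕ} {res : ℕ × ℝ}
    (l : List Item) {y : Item}
    (h : SearchOutcome pass l' (c + l.length + 1) (s + weight l + y.w) res)
    (hy : pass (c + l.length + 1) (s + weight l + y.w) y.w) :
    SearchOutcome pass (l ++ y :: l') c s res := by
  obtain ⟨A, B, rfl, hres, hA, hB⟩ := h
  have hcount : c + (l ++ y :: A).length = c + l.length + 1 + A.length := by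
    simp only [List.length_append, List.length_cons]
    ring
  have hsum : s + weight (l ++ y :: A) = s + weight l + y.w + weight A := by
    simp only [weight_append, weight_cons]
    ring
  refine ⟨l ++ y :: A, B, by simp, ?_⟩
  rw [hcount, hsum]
  refine ⟨hres, fun x hx => ?_, hB⟩
  cases A using List.reverseRecOn with
  | nil =>
    obtain rfl : y = x := by simpa using hx
    simpa using hy
  | append_singleton A z =>
    rw [← List.cons_append, ← List.append_assoc, List.getLast?_concat] at hx
    exact hA x (by rwa [List.getLast?_concat])

theorem search_spec {pass : ℕ → ℝ → ℝ → Prop} {test : ℕ → ℝ → ℝ → Timed Bool}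
    (hpass : ∀ c s w, (test c s w).val = true ↔ pass c s w) (ht : t.WellFormed) (c : ℕ) (s : ℝ) :
    SearchOutcome pass t.toList c s (search test t c s).val := by
  induction t generalizing c s with
  | nil => exact ⟨[], [], rfl, by simp [search], by simp, by simp⟩
  | node l y r _ _ _ ihl ihr =>
    simp only [search, Timed.val_bind, Timed.val_ite, ht.left.val_size, ht.left.val_total, nadd,
      radd, val_step]
    split_ifs with hy
    · exact searchOutcome_append_left _ (ihr ht.right _ _) ((hpass ..).1 hy)
    · exact searchOutcome_append_right (ihl ht.left c s) _ (mt (hpass ..).2 hy)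

theorem time_search_le {test : ℕ → ℝ → ℝ → Timed Bool} {q : ℕ}
    (hq : ∀ c s w, (test c s w).time ≤ q) (t : Tree) (c : ℕ) (s : ℝ) :
    (search test t c s).time ≤ (q + 6) * t.depth + 1 := by
  induction t generalizing c s with
  | nil => simp [search]
  | node l y r _ _ _ ihl ihr =>
    have htest := hq (c + l.size.val + 1) (s + l.total.val + y.w) y.w
    have hl := ihl c s
    have hr := ihr (c + l.size.val + 1) (s + l.total.val + y.w)
    have hle : (q + 6) * l.depth ≤ (q + 6) * max l.depth r.depth := by gcongr; exact le_max_left ..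
    have hre : (q + 6) * r.depth ≤ (q + 6) * max l.depth r.depth := by gcongr; exact le_max_right ..
    simp only [search, Timed.time_bind, Timed.time_ite, nadd, radd, val_step, time_step, time_size,
      time_total, depth_node, Nat.mul_succ]
    split_ifs <;> omega

end Tree

/-! ### Preparing the reservoir for a new item -/

section Insert

variable {t : Tree} {x : Item}

theorem perm_insertSorted (ht : t.WellFormed) (x : Item) :
    (insertSorted t x).val.toList.Perm (x :: t.toList) := by
  simp only [insertSorted, Timed.val_bind, Tree.toList_insertAt ht]
  exact List.perm_middle.trans (.of_eq (by rw [List.take_append_drop]))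

theorem pairwise_insertSorted (ht : t.WellFormed) (hsorted : t.toList.Pairwise (·.w ≤ ·.w))
    (x : Item) : (insertSorted t x).val.toList.Pairwise (·.w ≤ ·.w) := by
  obtain ⟨A, B, hAB, hres, hA, hB⟩ :
      Tree.SearchOutcome (fun _ _ w => w ≤ x.w) t.toList 0 0
        (t.search (fun _ _ w => rle w x.w) 0 0).val :=
    Tree.search_spec (fun _ _ _ => val_rle) ht 0 0
  simp only [insertSorted, Timed.val_bind, Tree.toList_insertAt ht, hres, zero_add]
  rw [hAB] at hsorted ⊢
  rw [List.take_left, List.drop_left]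
  have hsplit := List.pairwise_append.1 hsorted
  have hAx := le_of_getLast?_le hsplit.1 hA
  have hxB := lt_of_lt_head? hsplit.2.1 fun b hb => not_le.1 (hB b hb)
  refine List.pairwise_append.2 ⟨hsplit.1, List.pairwise_cons.2 ⟨fun b hb => (hxB b hb).le,
    hsplit.2.1⟩, fun a ha => List.forall_mem_cons.2 ⟨hAx a ha, hsplit.2.2 a ha⟩⟩

theorem insertSorted_wellFormed (ht : t.WellFormed) (x : Item) :
    (insertSorted t x).val.WellFormed ∧ (insertSorted t x).val.depth ≤ t.depth + 1 :=
  Tree.insertAt_wellFormed ht _ x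

theorem time_insertSorted_le (ht : t.WellFormed) (x : Item) :
    (insertSorted t x).time ≤ 264 * t.depth + 55 := by
  have hsearch := Tree.time_search_le (test := fun _ _ w => rle w x.w) (q := 1) (by simp) t 0 0
  have hinsert := Tree.time_insertAt_le ht (t.search (fun _ _ w => rle w x.w) 0 0).val.1 x
  simp only [insertSorted, Timed.time_bind]
  omega

end Insert

/-- An item with its weight as adjusted weight. -/
def Item.plain (x : Item) : ℕ × ℝ := (x.id, x.w)

/-- An item with the adjusted weight `θ`. -/
def Item.withWeight (θ : ℝ) (x : Item) : ℕ × ℝ := (x.id, θ)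

@[simp] theorem Item.snd_plain (x : Item) : x.plain.2 = x.w := rfl

@[simp] theorem Item.snd_withWeight (θ : ℝ) (x : Item) : (x.withWeight θ).2 = θ := rfl

@[simp] theorem adjSum_map_plain (l : List Item) : adjSum (l.map Item.plain) = weight l := by
  simp [adjSum, weight, Function.comp_def]

@[simp] theorem adjSum_map_withWeight (θ : ℝ) (l : List Item) :
    adjSum (l.map (Item.withWeight θ)) = l.length * θ := by
  simp [adjSum, Function.comp_def]

/-- The items in the reservoir. -/
def State.items (st : State) : List Item := st.small.toList ++ st.large.toList

/-- The invariant of the trees and of the threshold, apart from the size of the reservoir and the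
items seen so far. -/
structure State.WellFormed (st : State) : Prop where
  large : st.large.WellFormed
  small : st.small.WellFormed
  sorted : st.large.toList.Pairwise (·.w ≤ ·.w)
  thr_nonneg : 0 ≤ st.thr
  small_mem : ∀ y ∈ st.small.toList, y.w ∈ Set.Ioc 0 st.thr
  thr_lt : ∀ y ∈ st.large.toList, st.thr < y.w

open Classical in
/-- The new item as a list, if it is small for the current threshold, and no item otherwise. -/
noncomputable def fresh (st : State) (x : Item) : List Item := if x.w ≤ st.thr then [x] else []

/-- The small items together with a small new item, in the order in which the implementation
considers them for dropping. -/
noncomputable def smallItems (st : State) (x : Item) : List Item := fresh st x ++ st.small.toList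

/-- The items of `smallItems` with their adjusted weights. -/
noncomputable def smallSample (st : State) (x : Item) : List (ℕ × ℝ) :=
  (fresh st x).map Item.plain ++ st.small.toList.map (Item.withWeight st.thr)

section Prepare

variable {st : State} {x : Item} {pre : Pre}

theorem fresh_of_le (hx : x.w ≤ st.thr) : fresh st x = [x] := if_pos hx

theorem fresh_of_lt (hx : st.thr < x.w) : fresh st x = [] := if_neg hx.not_ge

theorem length_fresh_le (st : State) (x : Item) : (fresh st x).length ≤ 1 := by
  unfold fresh
  split_ifs <;> simp

theorem mem_smallSample {q : ℕ × ℝ} (hst : st.WellFormed) (hx : 0 < x.w)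
    (hq : q ∈ smallSample st x) : q.2 ∈ Set.Ioc 0 st.thr := by
  simp only [smallSample, fresh, List.mem_append, List.mem_map] at hq
  rcases hq with ⟨y, hy, rfl⟩ | ⟨y, hy, rfl⟩
  · split_ifs at hy with hle
    · rw [List.mem_singleton.1 hy]
      exact ⟨hx, hle⟩
    · simp at hy
  · exact ⟨(hst.small_mem y hy).1.trans_le (hst.small_mem y hy).2, le_rfl⟩

theorem pairwise_smallSample (hst : st.WellFormed) (hx : 0 < x.w) :
    (smallSample st x).Pairwise (·.2 ≤ ·.2) := by
  have hle {q : ℕ × ℝ} (hq : q ∈ smallSample st x) : q.2 ≤ st.thr := (mem_smallSample hst hx hq).2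
  refine List.pairwise_append.2 ⟨?_, ?_, fun a ha b hb => ?_⟩
  · unfold fresh
    split_ifs <;> simp
  · exact List.pairwise_map.2 (List.pairwise_of_forall fun _ _ => le_rfl)
  · obtain ⟨y, -, rfl⟩ := List.mem_map.1 hb
    exact hle (List.mem_append_left _ ha)

theorem length_sub_one_mul_thr_le (hst : st.WellFormed) (hx : 0 < x.w) :
    (((smallSample st x).length - 1 : ℕ) : ℝ) * st.thr ≤ adjSum (smallSample st x) := by
  have hlen : (smallSample st x).length - 1 ≤ st.small.toList.length := by
    have := length_fresh_le st x
    simp only [smallSample, List.length_append, List.length_map]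
    omega
  have hfresh : 0 ≤ weight (fresh st x) := by
    unfold fresh
    split_ifs <;> simp [hx.le]
  calc (((smallSample st x).length - 1 : ℕ) : ℝ) * st.thr
      ≤ st.small.toList.length * st.thr :=
        mul_le_mul_of_nonneg_right (by exact_mod_cast hlen) hst.thr_nonneg
    _ ≤ weight (fresh st x) + st.small.toList.length * st.thr := le_add_of_nonneg_left hfresh
    _ = adjSum (smallSample st x) := by simp [smallSample]

/-- The result of classifying the new item `x` and inserting it, if large, among the large items of
`st`. -/
structure Prepared (st : State) (x : Item) (pre : Pre) : Prop where
  large : pre.large.WellFormed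
  sorted : pre.large.toList.Pairwise (·.w ≤ ·.w)
  perm : (fresh st x ++ pre.large.toList).Perm (x :: st.large.toList)
  thr_lt : ∀ y ∈ pre.large.toList, st.thr < y.w
  isSmall_iff : pre.isSmall = true ↔ x.w ≤ st.thr
  count_eq : pre.count = (smallSample st x).length
  sum_eq : pre.sum = adjSum (smallSample st x)

theorem prepare_spec (hst : st.WellFormed) (x : Item) : Prepared st x (prepare st x).val := by
  simp only [prepare, Timed.val_bind, Timed.val_ite, val_rle, hst.small.val_size, toReal, rmul,
    nadd, radd, val_step, Timed.val_pure]
  split_ifs with hx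
  · refine ⟨hst.large, hst.sorted, ?_, hst.thr_lt, by simpa using hx, ?_, ?_⟩ <;>
      simp [smallSample, fresh_of_le hx, add_comm]
  · replace hx := not_le.1 hx
    have hperm := perm_insertSorted hst.large x
    refine ⟨(insertSorted_wellFormed hst.large x).1, pairwise_insertSorted hst.large hst.sorted x,
      ?_, fun y hy => ?_, by simpa using hx, ?_, ?_⟩
    · simpa [fresh_of_lt hx] using hperm
    · rcases List.mem_cons.1 (hperm.subset hy) with rfl | hy
      exacts [hx, hst.thr_lt y hy]
    all_goals simp [smallSample, fresh_of_lt hx]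

theorem depth_prepare_le (hst : st.WellFormed) (x : Item) :
    (prepare st x).val.large.depth ≤ st.large.depth + 1 := by
  simp only [prepare, Timed.val_bind, Timed.val_ite]
  split_ifs
  · exact Nat.le_succ _
  · exact (insertSorted_wellFormed hst.large x).2

theorem time_prepare_le (hst : st.WellFormed) (x : Item) :
    (prepare st x).time ≤ 264 * st.large.depth + 59 := by
  have hinsert := time_insertSorted_le hst.large x
  simp only [prepare, Timed.time_bind, Timed.time_ite, toReal, rmul, nadd, radd, time_step,
    time_rle, Tree.time_size, Timed.time_pure]
  split_ifs <;> omega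

end Prepare

/-! ### The new threshold -/

section Threshold

variable {k : ℕ} {st : State} {x : Item} {pre : Pre}

/-- The threshold which `processFull` computes from the result of `findCut`. -/
noncomputable def newThr (pre : Pre) : ℝ :=
  (findCut pre).val.2 / (((findCut pre).val.1 - 1 : ℕ) : ℝ)

theorem Prepared.length_add_length (h : Prepared st x pre) :
    (smallSample st x).length + pre.large.toList.length = st.items.length + 1 := by
  have hlen := h.perm.length_eq
  simp only [smallSample, State.items, List.length_append, List.length_map, List.length_cons]
    at hlen ⊢
  omega

theorem findCut_spec (h : Prepared st x pre) :
    Tree.SearchOutcome (fun c s w => ((c - 1 : ℕ) : ℝ) * w ≤ s) pre.large.toList pre.count pre.sum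
      (findCut pre).val :=
  Tree.search_spec (test := fun c s w => do
    let c' ← nsub c 1
    let cr ← toReal c'
    let a ← rmul cr w
    rle a s) (fun _ _ _ => val_rle) h.large _ _

theorem Prepared.exists_cut (hst : st.WellFormed) (h : Prepared st x pre) (hx : 0 < x.w)
    (hk : 1 ≤ k) (hcard : st.items.length = k) :
    ∃ A B, pre.large.toList = A ++ B ∧ (findCut pre).val.1 = pre.count + A.length ∧
      Cut k (newThr pre) (smallSample st x ++ A.map Item.plain) (B.map Item.plain) := by
  obtain ⟨A, B, hAB, hres, hA, hB⟩ := findCut_spec h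
  refine ⟨A, B, hAB, by rw [hres], ?_⟩
  set U := smallSample st x ++ A.map Item.plain with hU
  have hlen : pre.count + A.length = U.length := by simp [hU, h.count_eq]
  have hsum : pre.sum + weight A = adjSum U := by simp [hU, h.sum_eq]
  have hsplit : U ++ B.map Item.plain = smallSample st x ++ pre.large.toList.map Item.plain := by
    rw [hU, hAB, List.map_append, List.append_assoc]
  have hlt : ∀ q ∈ pre.large.toList.map Item.plain, st.thr < q.2 := List.forall_mem_map.2 h.thr_lt
  rw [newThr, hres, hlen, hsum]
  rw [hlen, hsum] at hA
  refine Cut.of_boundary hk ?_ ?_ ?_ (fun u hu => ?_) fun v hv => ?_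
  · rw [hsplit]
    exact List.forall_mem_append.2 ⟨fun q hq => (mem_smallSample hst hx hq).1,
      fun q hq => hst.thr_nonneg.trans_lt (hlt q hq)⟩
  · rw [hsplit]
    exact List.pairwise_append.2 ⟨pairwise_smallSample hst hx, List.pairwise_map.2 h.sorted,
      fun q hq q' hq' => (mem_smallSample hst hx hq).2.trans (hlt q' hq').le⟩
  · rw [← List.length_append, hsplit, List.length_append, List.length_map, h.length_add_length,
      hcard]
  · cases A using List.reverseRecOn with
    | nil =>
      simp only [List.map_nil, List.append_nil] at hU
      rw [hU] at hu ⊢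
      exact (mul_le_mul_of_nonneg_left (mem_smallSample hst hx (List.mem_of_mem_getLast? hu)).2
        (Nat.cast_nonneg _)).trans (length_sub_one_mul_thr_le hst hx)
    | append_singleton A y =>
      obtain rfl : y.plain = u := by simpa [hU] using hu
      exact hA y (by simp)
  · obtain ⟨y, hy, rfl⟩ : ∃ y ∈ B.head?, y.plain = v := by simpa using hv
    simpa [hlen, ← hsum] using hB y hy

theorem time_findCut_le (pre : Pre) : (findCut pre).time ≤ 10 * pre.large.depth + 1 :=
  Tree.time_search_le (by simp) _ _ _

end Threshold

/-! ### The item to drop -/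

section Drop

variable {τ ρ : ℝ}

@[simp] theorem val_excess (τ : ℝ) (c : ℕ) (s : ℝ) : (excess τ c s).val = c * τ - s := rfl

@[simp] theorem time_excess (τ : ℝ) (c : ℕ) (s : ℝ) : (excess τ c s).time = 3 := rfl

theorem crossesAt_search_small {θ : ℝ} {P : List (ℕ × ℝ)} {t : Tree}
    {test : ℕ → ℝ → ℝ → Timed Bool} (htest : ∀ c s w, (test c s w).val = true ↔
      c * τ - (adjSum P + (c - P.length : ℕ) * θ) < ρ)
    (ht : t.WellFormed) (hP : gap τ P < ρ)
    (h : ρ ≤ gap τ (P ++ t.toList.map (Item.withWeight θ))) :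
    CrossesAt τ ρ (P ++ t.toList.map (Item.withWeight θ)) (t.search test P.length 0).val.1 := by
  obtain ⟨A, B, hAB, hres, hA, hB⟩ := Tree.search_spec htest ht P.length 0
  have hcount : (t.search test P.length 0).val.1
      = (P ++ A.map (Item.withWeight θ)).length := by simp [hres]
  rw [hAB, List.map_append, ← List.append_assoc] at h ⊢
  rw [hcount]
  refine .of_boundary hP (fun a ha => ?_) (fun b hb => ?_) h
  · obtain ⟨y, hy, -⟩ : ∃ y ∈ A.getLast?, y.withWeight θ = a := by simpa using ha
    simpa [gap_eq_length_mul_sub] using hA y hy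
  · obtain ⟨y, hy, rfl⟩ : ∃ y ∈ B.head?, y.withWeight θ = b := by simpa using hb
    have hy := not_lt.1 (hB y hy)
    rw [add_assoc P.length, Nat.add_sub_cancel_left] at hy
    calc ρ ≤ _ := hy
      _ = _ := by
        rw [gap_eq_length_mul_sub]
        simp only [Nat.cast_add, Nat.cast_one, List.append_assoc, List.length_append,
          List.length_map, List.length_cons, List.length_nil, zero_add, adjSum_append,
          adjSum_map_withWeight, adjSum_cons, Item.snd_withWeight, adjSum_nil, add_zero]
        ring

theorem crossesAt_search_large {P : List (ℕ × ℝ)} {t : Tree} {A B : List Item}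
    {test : ℕ → ℝ → ℝ → Timed Bool}
    (htest : ∀ c s w, (test c s w).val = true ↔ w ≤ τ ∧ c * τ - s < ρ)
    (ht : t.WellFormed) (hsorted : t.toList.Pairwise (·.w ≤ ·.w)) (hAB : t.toList = A ++ B)
    (hA : ∀ a ∈ A, a.w ≤ τ) (hB : ∀ b ∈ B, τ < b.w) (hP : gap τ P < ρ)
    (h : ρ ≤ gap τ (P ++ A.map Item.plain)) :
    CrossesAt τ ρ (P ++ A.map Item.plain) (t.search test P.length (adjSum P)).val.1 := by
  obtain ⟨A', B', hAB', hres, hA', hB'⟩ := Tree.search_spec htest ht P.length (adjSum P)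
  rw [hAB'] at hsorted
  have hA'le : ∀ a ∈ A', a.w ≤ τ :=
    le_of_getLast?_le (List.pairwise_append.1 hsorted).1 fun a ha => (hA' a ha).1
  obtain ⟨C, rfl, rfl⟩ := exists_append_of_append_eq (hAB.symm.trans hAB') hA'le
    fun b hb => (hB b hb).not_ge
  have hcount : (t.search test P.length (adjSum P)).val.1
      = (P ++ A'.map Item.plain).length := by simp [hres]
  rw [List.map_append, ← List.append_assoc] at h ⊢
  rw [hcount]
  refine .of_boundary hP (fun a ha => ?_) (fun b hb => ?_) h
  · obtain ⟨y, hy, -⟩ : ∃ y ∈ A'.getLast?, y.plain = a := by simpa using ha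
    simpa [gap_eq_length_mul_sub] using (hA' y hy).2
  · obtain ⟨y, hy, rfl⟩ : ∃ y ∈ C.head?, y.plain = b := by simpa using hb
    have hyτ : y.w ≤ τ := hA y (List.mem_append_right _ (List.mem_of_mem_head? hy))
    have hyB' : y ∈ (C ++ B).head? := by simp [List.head?_append, Option.mem_def.1 hy]
    have hy := not_lt.1 fun hlt => hB' y hyB' ⟨hyτ, hlt⟩
    calc ρ ≤ _ := hy
      _ = _ := by
        rw [gap_eq_length_mul_sub]
        simp only [Nat.cast_add, Nat.cast_one, List.append_assoc, List.length_append,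
          List.length_map, List.length_cons, List.length_nil, zero_add, adjSum_append,
          adjSum_map_plain, adjSum_cons, Item.snd_plain, adjSum_nil, add_zero]
        ring

theorem findDropOld_spec {st : State} {pre : Pre} {P : List (ℕ × ℝ)} {A B : List Item}
    (hsmall : st.small.WellFormed) (hlarge : pre.large.WellFormed)
    (hsorted : pre.large.toList.Pairwise (·.w ≤ ·.w))
    (hcount : pre.count = (P ++ st.small.toList.map (Item.withWeight st.thr)).length)
    (hsum : pre.sum = adjSum (P ++ st.small.toList.map (Item.withWeight st.thr)))
    (hAB : pre.large.toList = A ++ B) (hA : ∀ a ∈ A, a.w ≤ τ) (hB : ∀ b ∈ B, τ < b.w)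
    (hP : gap τ P < ρ)
    (h : ρ ≤ gap τ (P ++ st.small.toList.map (Item.withWeight st.thr) ++ A.map Item.plain)) :
    CrossesAt τ ρ (P ++ st.small.toList.map (Item.withWeight st.thr) ++ A.map Item.plain)
      (findDropOld st pre τ ρ P.length (adjSum P)).val := by
  simp only [findDropOld, Timed.val_bind, Timed.val_ite, val_rle, val_excess, Timed.val_pure,
    hcount, hsum, ← gap_eq_length_mul_sub]
  split_ifs with hin
  · exact (crossesAt_search_small (fun _ _ _ => by simp) hsmall hP hin).append_right _
  · exact crossesAt_search_large (fun _ _ _ => by simp) hlarge hsorted hAB hA hB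
      (not_le.1 hin) h

theorem time_findDropOld_le (st : State) (pre : Pre) (c₀ : ℕ) (a₀ : ℝ) :
    (findDropOld st pre τ ρ c₀ a₀).time ≤ 14 * max st.small.depth pre.large.depth + 5 := by
  have hsmall := Tree.time_search_le (t := st.small) (c := c₀) (s := 0) (q := 8)
    (test := fun c _ _ => do
      let m ← nsub c c₀
      let mr ← toReal m
      let a ← rmul mr st.thr
      let s ← radd a₀ a
      let v ← excess τ c s
      rlt v ρ) (by simp)
  have hlarge := Tree.time_search_le (t := pre.large) (c := pre.count) (s := pre.sum) (q := 5)
    (test := fun c s w => do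
      let below ← rle w τ
      if below then do
        let v ← excess τ c s
        rlt v ρ
      else pure false) (fun c s w => by
        simp only [Timed.time_bind, Timed.time_ite, time_rle, time_excess, time_rlt,
          Timed.time_pure]
        split_ifs <;> simp)
  simp only [findDropOld, Timed.time_bind, Timed.time_ite, time_excess, time_rle, Timed.time_pure]
  split_ifs <;> omega

theorem findDrop_spec {k : ℕ} {st : State} {x : Item} {pre : Pre} {A B : List Item} {r : ℝ}
    (hst : st.WellFormed) (h : Prepared st x pre) (hAB : pre.large.toList = A ++ B)
    (hcut : Cut k τ (smallSample st x ++ A.map Item.plain) (B.map Item.plain))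
    (hr : r ∈ Set.Ioo (0 : ℝ) 1) :
    CrossesAt τ (r * τ) (smallSample st x ++ A.map Item.plain) (findDrop st x pre τ r).val := by
  have hρ : 0 < r * τ := mul_pos hr.1 hcut.thr_pos
  have hρle : r * τ ≤ gap τ (smallSample st x ++ A.map Item.plain) := by
    rw [hcut.gap_eq]
    exact mul_le_of_le_one_left hcut.thr_pos.le hr.2.le
  have hA : ∀ a ∈ A, a.w ≤ τ := fun a ha =>
    hcut.le _ (List.mem_append_right _ (List.mem_map_of_mem ha))
  have hB : ∀ b ∈ B, τ < b.w := fun b hb => hcut.lt _ (List.mem_map_of_mem hb)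
  have hold (hfresh : gap τ ((fresh st x).map Item.plain) < r * τ) :=
    findDropOld_spec hst.small h.large h.sorted h.count_eq h.sum_eq hAB hA hB hfresh hρle
  simp only [findDrop, Timed.val_bind, Timed.val_ite, h.isSmall_iff, rmul, rsub, val_step, val_rle]
  split_ifs with hx hfirst
  · simp only [smallSample, fresh_of_le hx, List.map_cons, List.map_nil, List.append_assoc]
    exact CrossesAt.append_right ⟨by simp, by simpa using hρ, by simpa using hfirst⟩ _
  · simpa [smallSample, fresh_of_le hx] using hold (by simpa [fresh_of_le hx] using hfirst)
  · rw [not_le] at hx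
    simpa [smallSample, fresh_of_lt hx] using hold (by simpa [fresh_of_lt hx] using hρ)

theorem time_findDrop_le (st : State) (x : Item) (pre : Pre) (τ r : ℝ) :
    (findDrop st x pre τ r).time ≤ 14 * max st.small.depth pre.large.depth + 8 := by
  have hone := time_findDropOld_le (τ := τ) (ρ := r * τ) st pre 1 x.w
  have hzero := time_findDropOld_le (τ := τ) (ρ := r * τ) st pre 0 0
  simp only [findDrop, Timed.time_bind, Timed.time_ite, rmul, rsub, val_step, time_step, time_rle]
  split_ifs <;> omega

end Drop

/-! ### Processing an item -/

section Round

variable {k p : ℕ} {st : State} {x : Item} {pre : Pre} {sm : Tree}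

theorem toList_insertSmall (hst : st.WellFormed) (h : pre.isSmall = true ↔ x.w ≤ st.thr) :
    (insertSmall st x pre).val.toList = smallItems st x := by
  simp only [insertSmall, Timed.val_ite, h, smallItems]
  split_ifs with hx
  · simp [Tree.toList_insertAt hst.small, fresh_of_le hx]
  · simp [fresh_of_lt (not_le.1 hx)]

theorem insertSmall_wellFormed (hst : st.WellFormed) (x : Item) (pre : Pre) :
    (insertSmall st x pre).val.WellFormed ∧
      (insertSmall st x pre).val.depth ≤ st.small.depth + 1 := by
  simp only [insertSmall, Timed.val_ite]
  split_ifs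
  · exact Tree.insertAt_wellFormed hst.small 0 x
  · exact ⟨hst.small, Nat.le_succ _⟩

theorem time_insertSmall_le (hst : st.WellFormed) (x : Item) (pre : Pre) :
    (insertSmall st x pre).time ≤ 257 * st.small.depth + 54 := by
  simp only [insertSmall, Timed.time_ite]
  split_ifs
  · exact Tree.time_insertAt_le hst.small 0 x
  · exact Nat.zero_le _

theorem dropItem_spec {A B : List Item} (hsm : sm.WellFormed) (hlarge : pre.large.WellFormed)
    (hAB : pre.large.toList = A ++ B) (hcount : pre.count = sm.toList.length)
    (hp : p < pre.count + A.length) :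
    let res := (dropItem sm pre (pre.count + A.length) p).val
    res.1.toList ++ res.2.1.toList.take res.2.2 = (sm.toList ++ A).eraseIdx p ∧
      res.2.1.toList.drop res.2.2 = B := by
  simp only [dropItem, Timed.val_bind, Timed.val_ite, val_nlt, nsub, val_step, Timed.val_pure,
    Nat.add_sub_cancel_left]
  split_ifs with hlt
  · rw [Tree.toList_deleteAt hsm, hAB, List.take_left, List.drop_left,
      List.eraseIdx_append_of_lt_length (hcount ▸ hlt)]
    exact ⟨rfl, rfl⟩
  · have hq : p - pre.count < A.length := by omega
    have hlen : A.length - 1 = (A.eraseIdx (p - pre.count)).length := by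
      rw [List.length_eraseIdx_of_lt hq]
    rw [Tree.toList_deleteAt hlarge, hAB, List.eraseIdx_append_of_lt_length hq, hlen,
      List.take_left, List.drop_left, List.eraseIdx_append_of_length_le (by omega), hcount]
    exact ⟨rfl, rfl⟩

theorem dropItem_count_le (sm : Tree) (pre : Pre) (t p : ℕ) :
    (dropItem sm pre t p).val.2.2 ≤ t - pre.count := by
  simp only [dropItem, Timed.val_bind, Timed.val_ite, nsub, val_step, Timed.val_pure]
  split_ifs
  · exact le_rfl
  · exact Nat.sub_le _ _

theorem dropItem_wellFormed (hsm : sm.WellFormed) (hlarge : pre.large.WellFormed) (t p : ℕ) :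
    let res := (dropItem sm pre t p).val
    (res.1.WellFormed ∧ res.1.depth ≤ sm.depth + 1) ∧
      res.2.1.WellFormed ∧ res.2.1.depth ≤ pre.large.depth + 1 := by
  simp only [dropItem, Timed.val_bind, Timed.val_ite, Timed.val_pure]
  split_ifs
  · exact ⟨Tree.deleteAt_wellFormed hsm p, hlarge, Nat.le_succ _⟩
  · exact ⟨⟨hsm, Nat.le_succ _⟩, Tree.deleteAt_wellFormed hlarge _⟩

theorem time_dropItem_le (hsm : sm.WellFormed) (hlarge : pre.large.WellFormed) (t p : ℕ) :
    (dropItem sm pre t p).time ≤ 563 * max sm.depth pre.large.depth + 58 := by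
  have hdel := Tree.time_deleteAt_le hsm p
  have hdel' := Tree.time_deleteAt_le hlarge (p - pre.count)
  simp only [dropItem, Timed.time_bind, Timed.time_ite, nsub, val_step, time_step, time_nlt,
    Timed.time_pure]
  split_ifs <;> omega

theorem val_processFull (st : State) (x : Item) (r : ℝ) :
    let pre := (prepare st x).val
    let cut := (findCut pre).val.1
    let res := (dropItem (insertSmall st x pre).val pre cut
      (findDrop st x pre (newThr pre) r).val).val
    (processFull st x r).val =
      if pre.count < cut then
        ⟨(res.2.1.split res.2.2).val.2, (res.1.concat (res.2.1.split res.2.2).val.1).val,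
          newThr pre⟩
      else ⟨res.2.1, res.1, newThr pre⟩ := by
  simp only [processFull, Timed.val_bind, Timed.val_ite, val_nlt]
  rfl

theorem processFull_trees_wellFormed (hst : st.WellFormed) (x : Item) (r : ℝ) :
    (processFull st x r).val.large.WellFormed ∧ (processFull st x r).val.small.WellFormed := by
  obtain ⟨⟨hsm, -⟩, hla, -⟩ := dropItem_wellFormed
    (insertSmall_wellFormed hst x (prepare st x).val).1 (prepare_spec hst x).large
    (findCut (prepare st x).val).val.1
    (findDrop st x (prepare st x).val (newThr (prepare st x).val) r).val
  rw [val_processFull]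
  split_ifs
  · obtain ⟨⟨ha, -⟩, hb, -⟩ := Tree.split_wellFormed hla _
    exact ⟨hb, (Tree.concat_wellFormed hsm ha).1⟩
  · exact ⟨hla, hsm⟩

theorem toList_processFull {A B : List Item} {r : ℝ} (hst : st.WellFormed)
    (hAB : (prepare st x).val.large.toList = A ++ B)
    (hcut : (findCut (prepare st x).val).val.1 = (prepare st x).val.count + A.length)
    (hp : (findDrop st x (prepare st x).val (newThr (prepare st x).val) r).val = p)
    (hlt : p < (smallItems st x ++ A).length) :
    (processFull st x r).val.small.toList = (smallItems st x ++ A).eraseIdx p ∧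
      (processFull st x r).val.large.toList = B := by
  have hpre := prepare_spec hst x
  have hsm := (insertSmall_wellFormed hst x (prepare st x).val).1
  have hsmList := toList_insertSmall hst hpre.isSmall_iff
  have hcount : (prepare st x).val.count = (smallItems st x).length := by
    simp [hpre.count_eq, smallSample, smallItems]
  obtain ⟨hsmall, hlarge⟩ := dropItem_spec (p := p) hsm hpre.large hAB (by rw [hcount, hsmList])
    (by simpa [hcount] using hlt)
  obtain ⟨-, hla, -⟩ :=
    dropItem_wellFormed hsm hpre.large ((prepare st x).val.count + A.length) p
  have hmoved := dropItem_count_le (insertSmall st x (prepare st x).val).val (prepare st x).val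
    ((prepare st x).val.count + A.length) p
  rw [hsmList] at hsmall
  rw [val_processFull, hcut, hp]
  split_ifs with h
  · rw [Tree.toList_concat, (Tree.toList_split hla _).1, (Tree.toList_split hla _).2]
    exact ⟨hsmall, hlarge⟩
  · rw [Nat.le_zero.1 (hmoved.trans (by omega)), List.take_zero, List.append_nil] at hsmall
    rw [Nat.le_zero.1 (hmoved.trans (by omega)), List.drop_zero] at hlarge
    exact ⟨hsmall, hlarge⟩

theorem Prepared.thr_le_of_cut {A B : List Item} {τ : ℝ} {V : List (ℕ × ℝ)} (h : Prepared st x pre)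
    (hAB : pre.large.toList = A ++ B)
    (hcut : Cut k τ (smallSample st x ++ A.map Item.plain) V) : st.thr ≤ τ := by
  have htwo := hcut.two_le_length
  have hfresh := length_fresh_le st x
  rcases st.small.toList.eq_nil_or_concat' with hnil | ⟨l, y, hl⟩
  · have hA : 0 < A.length := by
      simp only [smallSample, hnil, List.length_append, List.length_map, List.length_nil] at htwo
      omega
    obtain ⟨a, ha⟩ := List.exists_mem_of_length_pos hA
    exact (h.thr_lt a (by simp [hAB, ha])).le.trans
      (hcut.le a.plain (List.mem_append_right _ (List.mem_map_of_mem ha)))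
  · exact hcut.le (y.withWeight st.thr) (by simp [smallSample, hl])

theorem rest_eq_map (τ : ℝ) (st : State) (x : Item) (A B : List Item) (p : ℕ) :
    rest τ (smallSample st x ++ A.map Item.plain) (B.map Item.plain) p
      = ((smallItems st x ++ A).eraseIdx p).map (Item.withWeight τ) ++ B.map Item.plain := by
  have hmap : (smallSample st x ++ A.map Item.plain).map (fun q => (q.1, τ))
      = (smallItems st x ++ A).map (Item.withWeight τ) := by
    simp only [smallSample, smallItems, List.map_append, List.map_map]
    rfl
  rw [rest, ← List.eraseIdx_map, hmap, List.eraseIdx_map]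

theorem Prepared.perm_items (h : Prepared st x pre) :
    (smallItems st x ++ pre.large.toList).Perm (x :: st.items) := by
  have hswap := (List.perm_append_comm (l₁ := fresh st x) (l₂ := st.small.toList)).append_right
    pre.large.toList
  rw [List.append_assoc st.small.toList] at hswap
  exact hswap.trans ((h.perm.append_left _).trans List.perm_middle)

theorem Prepared.perm_sample (h : Prepared st x pre) :
    (smallSample st x ++ pre.large.toList.map Item.plain).Perm (x.plain :: st.sample) := by
  have hperm := h.perm.map Item.plain
  rw [List.map_append, List.map_cons] at hperm
  have hswap := (List.perm_append_comm (l₁ := (fresh st x).map Item.plain)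
    (l₂ := st.small.toList.map (Item.withWeight st.thr))).append_right
    (pre.large.toList.map Item.plain)
  rw [List.append_assoc (st.small.toList.map _)] at hswap
  exact hswap.trans ((hperm.append_left _).trans List.perm_middle)

theorem mem_smallItems {y : Item} (hst : st.WellFormed) (hx : 0 < x.w)
    (hy : y ∈ smallItems st x) : y.w ∈ Set.Ioc 0 st.thr := by
  simp only [smallItems, fresh, List.mem_append] at hy
  rcases hy with hy | hy
  · split_ifs at hy with hle
    · rw [List.mem_singleton.1 hy]
      exact ⟨hx, hle⟩
    · simp at hy
  · exact hst.small_mem y hy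

theorem processFull_wellFormed {A B : List Item} {r : ℝ} (hst : st.WellFormed) (hx : 0 < x.w)
    (hAB : (prepare st x).val.large.toList = A ++ B)
    (hcut : Cut k (newThr (prepare st x).val) (smallSample st x ++ A.map Item.plain)
      (B.map Item.plain))
    (hsmall : (processFull st x r).val.small.toList = (smallItems st x ++ A).eraseIdx p)
    (hlarge : (processFull st x r).val.large.toList = B)
    (hthr : (processFull st x r).val.thr = newThr (prepare st x).val) :
    (processFull st x r).val.WellFormed where
  large := (processFull_trees_wellFormed hst x r).1
  small := (processFull_trees_wellFormed hst x r).2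
  sorted := by
    rw [hlarge]
    exact (List.pairwise_append.1 (hAB ▸ (prepare_spec hst x).sorted)).2.1
  thr_nonneg := hthr ▸ hcut.thr_pos.le
  small_mem y hy := by
    rw [hsmall] at hy
    rw [hthr]
    rcases List.mem_append.1 (List.mem_of_mem_eraseIdx hy) with hy | hy
    · obtain ⟨hpos, hle⟩ := mem_smallItems hst hx hy
      exact ⟨hpos, hle.trans ((prepare_spec hst x).thr_le_of_cut hAB hcut)⟩
    · have hmem :=
        List.mem_append_right (smallSample st x) (List.mem_map_of_mem (f := Item.plain) hy)
      exact ⟨hcut.pos _ (List.mem_append_left _ hmem), hcut.le _ hmem⟩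
  thr_lt y hy := by
    rw [hlarge] at hy
    rw [hthr]
    exact hcut.lt _ (List.mem_map_of_mem hy)

theorem thr_processFull (st : State) (x : Item) (r : ℝ) :
    (processFull st x r).val.thr = newThr (prepare st x).val := by
  rw [val_processFull]
  split_ifs <;> rfl

theorem processFull_spec (hst : st.WellFormed) (hx : 0 < x.w) (hk : 1 ≤ k)
    (hcard : st.items.length = k) :
    ∃ τ U V, Cut k τ U V ∧ (U ++ V).Perm (x.plain :: st.sample) ∧ st.thr ≤ τ ∧
      ∀ r ∈ Set.Ioo (0 : ℝ) 1, (processFull st x r).val.WellFormed ∧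
        (processFull st x r).val.thr = τ ∧
        (∀ y ∈ (processFull st x r).val.items, y ∈ x :: st.items) ∧
        ∃ p, CrossesAt τ (r * τ) U p ∧ (processFull st x r).val.sample = rest τ U V p := by
  have hpre := prepare_spec hst x
  obtain ⟨A, B, hAB, hcount, hcut⟩ := hpre.exists_cut hst hx hk hcard
  refine ⟨_, _, _, hcut, ?_, hpre.thr_le_of_cut hAB hcut, fun r hr => ?_⟩
  · rw [List.append_assoc, ← List.map_append, ← hAB]
    exact hpre.perm_sample
  have hcross := findDrop_spec hst hpre hAB hcut hr
  have hlt := hcross.lt_length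
  obtain ⟨hsmall, hlarge⟩ := toList_processFull (r := r) hst hAB hcount rfl
    (by simpa [smallSample, smallItems] using hlt)
  have hthr := thr_processFull st x r
  refine ⟨processFull_wellFormed hst hx hAB hcut hsmall hlarge hthr, hthr, fun y hy => ?_, _,
    hcross, ?_⟩
  · refine hpre.perm_items.subset ?_
    rw [hAB, ← List.append_assoc]
    rw [State.items, hsmall, hlarge] at hy
    exact List.mem_append.2 ((List.mem_append.1 hy).imp_left List.mem_of_mem_eraseIdx)
  · rw [rest_eq_map, ← hsmall, ← hthr, ← hlarge]
    rfl

theorem time_processFull (st : State) (x : Item) (r : ℝ) :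
    let pre := (prepare st x).val
    let cut := (findCut pre).val.1
    let drop := findDrop st x pre (newThr pre) r
    let item := dropItem (insertSmall st x pre).val pre cut drop.val
    let split := item.val.2.1.split item.val.2.2
    (processFull st x r).time =
      (prepare st x).time + (findCut pre).time + drop.time + (insertSmall st x pre).time
        + item.time + (if pre.count < cut then split.time + (item.val.1.concat split.val.1).time
          else 0) + 4 := by
  simp only [processFull, Timed.time_bind, Timed.time_ite, nsub, toReal, rdiv, val_step, time_step,
    time_nlt, val_nlt, Timed.time_pure, newThr]
  split_ifs <;> ring

theorem time_processFull_le {D : ℕ} (hst : st.WellFormed) (hsmall : st.small.depth ≤ D)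
    (hlarge : st.large.depth ≤ D) (x : Item) (r : ℝ) :
    (processFull st x r).time ≤ 1518 * D + 1645 := by
  have hpre := prepare_spec hst x
  have hprepare := time_prepare_le hst x
  have hdepth := depth_prepare_le hst x
  rw [time_processFull]
  generalize (prepare st x).val = pre at *
  have hcut := time_findCut_le pre
  have hdrop := time_findDrop_le st x pre (newThr pre) r
  have hinsert := time_insertSmall_le hst x pre
  obtain ⟨hsm, hsmle⟩ := insertSmall_wellFormed hst x pre
  generalize findDrop st x pre (newThr pre) r = drop at *
  have hitem := time_dropItem_le hsm hpre.large (findCut pre).val.1 drop.val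
  obtain ⟨⟨hs, hsle⟩, hl, hlle⟩ :=
    dropItem_wellFormed hsm hpre.large (findCut pre).val.1 drop.val
  generalize dropItem (insertSmall st x pre).val pre (findCut pre).val.1 drop.val = item at *
  have hsplit := Tree.time_split_le hl item.val.2.2
  obtain ⟨⟨ha, hale⟩, -, hble⟩ := Tree.split_wellFormed hl item.val.2.2
  have hconcat := Tree.time_concat_le hs ha
  split_ifs <;> omega

theorem val_process_of_lt (hst : st.WellFormed) (hlt : st.items.length < k) (x : Item) (r : ℝ) :
    (process k st x r).val = ⟨(insertSorted st.large x).val, st.small, st.thr⟩ := by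
  rw [State.items, List.length_append, add_comm] at hlt
  simp [process, hst.large.val_size, hst.small.val_size, hlt]

theorem val_process_of_le (hst : st.WellFormed) (hle : k ≤ st.items.length) (x : Item) (r : ℝ) :
    (process k st x r).val = (processFull st x r).val := by
  rw [State.items, List.length_append, add_comm, ← not_lt] at hle
  simp [process, hst.large.val_size, hst.small.val_size, hle]

theorem time_process_le {D : ℕ} (hst : st.WellFormed) (hsmall : st.small.depth ≤ D)
    (hlarge : st.large.depth ≤ D) (x : Item) (r : ℝ) :
    (process k st x r).time ≤ 1518 * D + 1649 := by
  have hfill := time_insertSorted_le hst.large x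
  have hfull := time_processFull_le hst hsmall hlarge x r
  simp only [process, Timed.time_bind, Timed.time_ite, Tree.time_size, nadd, time_step, time_nlt,
    Timed.time_pure]
  split_ifs <;> omega

end Round

/-! ### The invariant of a run -/

section Invariant

variable {k j : ℕ} {w : ℕ → ℝ} {st : State}

theorem map_fst_sample (st : State) : st.sample.map Prod.fst = st.items.map Item.id := by
  simp [State.sample, State.items, Function.comp_def]

theorem length_sample (st : State) : st.sample.length = st.items.length := by
  simp [State.sample, State.items]

theorem State.WellFormed.minSum_thr (hst : st.WellFormed) (hthr : 0 < st.thr) :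
    minSum st.thr st.sample = st.sample.length := by
  refine minSum_of_ge hthr fun q hq => ?_
  rcases List.mem_append.1 hq with hq | hq <;> obtain ⟨y, hy, rfl⟩ := List.mem_map.1 hq
  exacts [le_rfl, (hst.thr_lt y hy).le]

/-- The invariant of a run. In contrast to `Represents` it determines `∑ min 1 (w i / σ)` for all
`σ` from the threshold on, since the threshold of the next round is not yet known. -/
structure Invariant (k : ℕ) (w : ℕ → ℝ) (j : ℕ) (st : State) : Prop where
  wellFormed : st.WellFormed
  mem_items : ∀ y ∈ st.items, y.id < j ∧ y.w = w y.id
  nodup : (st.sample.map Prod.fst).Nodup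
  card : st.items.length = min j k
  thr_init : j ≤ k → st.thr = 0
  thr_pos : k < j → 0 < st.thr
  minSum_eq : ∀ σ, st.thr ≤ σ → 0 < σ →
    minSum σ st.sample = ∑ i ∈ Finset.range j, min 1 (w i / σ)

namespace Invariant

theorem represents (h : Invariant k w j st) : Represents k w j st where
  large_balanced := h.wellFormed.large.balanced
  small_balanced := h.wellFormed.small.balanced
  large_augmented := h.wellFormed.large.augmented
  small_augmented := h.wellFormed.small.augmented
  large_sorted := List.pairwise_map.2 h.wellFormed.sorted
  large_items y hy :=
    have hmem := h.mem_items y (List.mem_append_right _ hy)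
    ⟨hmem.1, hmem.2, h.wellFormed.thr_lt y hy⟩
  small_items y hy :=
    have hmem := h.mem_items y (List.mem_append_left _ hy)
    ⟨hmem.1, hmem.2, (h.wellFormed.small_mem y hy).2⟩
  nodup := h.nodup
  card := (length_sample st).trans h.card
  thr_init := h.thr_init
  thr_pos := h.thr_pos
  thr_eq hj := by
    rw [← h.minSum_eq _ le_rfl (h.thr_pos hj), h.wellFormed.minSum_thr (h.thr_pos hj),
      length_sample, h.card, min_eq_right hj.le]

theorem init (k : ℕ) (w : ℕ → ℝ) : Invariant k w 0 State.init where
  wellFormed :=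
    { large := Tree.wellFormed_nil
      small := Tree.wellFormed_nil
      sorted := .nil
      thr_nonneg := le_rfl
      small_mem := by simp [State.init]
      thr_lt := by simp [State.init] }
  mem_items := by simp [State.items, State.init]
  nodup := by simp [State.sample, State.init]
  card := by simp [State.items, State.init]
  thr_init _ := rfl
  thr_pos hj := absurd hj (Nat.not_lt_zero k)
  minSum_eq := by simp [State.sample, State.init, minSum]

theorem mem_cons_items (h : Invariant k w j st) {y : Item} (hy : y ∈ ⟨j, w j⟩ :: st.items) :
    y.id < j + 1 ∧ y.w = w y.id := by
  rcases List.mem_cons.1 hy with rfl | hy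
  · exact ⟨Nat.lt_succ_self j, rfl⟩
  · exact (h.mem_items y hy).imp_left Nat.lt_succ_of_lt

theorem nodup_cons (h : Invariant k w j st) (a : ℝ) :
    (((j, a) :: st.sample).map Prod.fst).Nodup := by
  refine List.nodup_cons.2 ⟨fun hj => ?_, h.nodup⟩
  rw [map_fst_sample] at hj
  obtain ⟨y, hy, hid⟩ := List.mem_map.1 hj
  exact (h.mem_items y hy).1.ne hid

theorem minSum_cons_eq (h : Invariant k w j st) {σ : ℝ} (hσ : st.thr ≤ σ) (hσ0 : 0 < σ) :
    minSum σ ((j, w j) :: st.sample) = ∑ i ∈ Finset.range (j + 1), min 1 (w i / σ) := by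
  rw [minSum_cons, h.minSum_eq σ hσ hσ0, Finset.sum_range_succ, add_comm]

theorem sample_process_perm (h : Invariant k w j st) (hj : j < k) (r : ℝ) :
    (process k st ⟨j, w j⟩ r).val.sample.Perm ((j, w j) :: st.sample) := by
  rw [val_process_of_lt h.wellFormed (h.card.trans_lt (min_lt_of_left_lt hj))]
  have hperm := (perm_insertSorted h.wellFormed.large ⟨j, w j⟩).map Item.plain
  exact (hperm.append_left _).trans List.perm_middle

theorem process_of_lt (h : Invariant k w j st) (hwj : 0 < w j) (hj : j < k) (r : ℝ) :
    Invariant k w (j + 1) (process k st ⟨j, w j⟩ r).val := by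
  have hsample := h.sample_process_perm hj r
  have hthr := h.thr_init hj.le
  rw [val_process_of_lt h.wellFormed (h.card.trans_lt (min_lt_of_left_lt hj))] at hsample ⊢
  have hlarge := perm_insertSorted h.wellFormed.large ⟨j, w j⟩
  have hst := h.wellFormed
  refine ⟨⟨(insertSorted_wellFormed hst.large _).1, hst.small,
    pairwise_insertSorted hst.large hst.sorted _, hst.thr_nonneg, hst.small_mem, fun y hy => ?_⟩,
    fun y hy => h.mem_cons_items ?_, ?_, ?_, fun _ => hthr, fun hk => by omega,
    fun σ hσ hσ0 => ?_⟩
  · rcases List.mem_cons.1 (hlarge.subset hy) with rfl | hy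
    exacts [hthr.trans_lt hwj, hst.thr_lt y hy]
  · exact ((hlarge.append_left _).trans List.perm_middle).subset hy
  · exact (hsample.map Prod.fst).nodup_iff.2 (h.nodup_cons _)
  · rw [← length_sample, hsample.length_eq, List.length_cons, length_sample, h.card]
    omega
  · exact (minSum_perm hsample).trans (h.minSum_cons_eq hσ hσ0)

theorem process_of_le (h : Invariant k w j st) (hk : 1 ≤ k) (hwj : 0 < w j) (hj : k ≤ j) :
    ∃ τ U V, Cut k τ U V ∧ (U ++ V).Perm ((j, w j) :: st.sample) ∧
      ∀ r ∈ Set.Ioo (0 : ℝ) 1, Invariant k w (j + 1) (process k st ⟨j, w j⟩ r).val ∧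
        (process k st ⟨j, w j⟩ r).val.thr = τ ∧
        ∃ p, CrossesAt τ (r * τ) U p ∧
          (process k st ⟨j, w j⟩ r).val.sample = rest τ U V p := by
  have hcard : st.items.length = k := h.card.trans (min_eq_right hj)
  obtain ⟨τ, U, V, hcut, hperm, hle, hround⟩ :=
    processFull_spec (x := ⟨j, w j⟩) h.wellFormed hwj hk hcard
  refine ⟨τ, U, V, hcut, hperm, fun r hr => ?_⟩
  rw [val_process_of_le h.wellFormed hcard.ge]
  obtain ⟨hst, hthr, hitems, p, hp, hsample⟩ := hround r hr
  refine ⟨⟨hst, fun y hy => h.mem_cons_items (hitems y hy), ?_, ?_, fun hjk => by omega,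
    fun _ => hthr ▸ hcut.thr_pos, fun σ hσ hσ0 => ?_⟩, hthr, p, hp, hsample⟩
  · rw [hsample, map_fst_rest hp.lt_length]
    exact ((hperm.map Prod.fst).nodup_iff.2 (h.nodup_cons _)).sublist (List.eraseIdx_sublist _ _)
  · have hcard := hcut.card
    have hlt := hp.lt_length
    rw [← length_sample, hsample, rest, List.length_append, List.length_map,
      List.length_eraseIdx_of_lt hlt]
    omega
  · rw [hthr] at hσ
    rw [hsample, hcut.minSum_rest hσ hp.lt_length, minSum_perm hperm]
    exact h.minSum_cons_eq (hle.trans hσ) hσ0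

theorem run {r : ℕ → ℝ} (hk : 1 ≤ k) (hw : ∀ i, 0 < w i) (hr : ∀ i, r i ∈ Set.Ioo (0 : ℝ) 1)
    (j : ℕ) : Invariant k w j (run k w r j) := by
  induction j with
  | zero => exact init k w
  | succ j ih =>
    rcases lt_or_ge j k with hj | hj
    · exact ih.process_of_lt (hw j) hj (r j)
    · obtain ⟨_, _, _, -, -, hround⟩ := ih.process_of_le hk (hw j) hj
      exact (hround (r j) (hr j)).1

theorem depth_le (h : Invariant k w j st) :
    max (st.small.depth : ℝ) st.large.depth ≤ Real.log (k + 1) / Real.log Real.goldenRatio := by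
  have hlength : st.small.toList.length + st.large.toList.length ≤ k := by
    rw [← List.length_append]
    exact h.card.trans_le (min_le_right j k)
  have hlog {t : Tree} (ht : t.WellFormed) (hle : t.toList.length ≤ k) :
      (t.depth : ℝ) ≤ Real.log (k + 1) / Real.log Real.goldenRatio :=
    (Tree.depth_le_log ht.balanced).trans <| div_le_div_of_nonneg_right
      (Real.log_le_log (by positivity) (by gcongr)) (Real.log_pos Real.one_lt_goldenRatio).le
  exact max_le (hlog h.wellFormed.small (by omega)) (hlog h.wellFormed.large (by omega))

theorem time_process_le (h : Invariant k w j st) (hk : 1 ≤ k) (x : Item) (r : ℝ) :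
    ((process k st x r).time : ℝ) ≤ 3167 / Real.log Real.goldenRatio * Real.log (k + 1) := by
  have hk' : (1 : ℝ) ≤ k := by exact_mod_cast hk
  have hone : 1 ≤ Real.log (k + 1) / Real.log Real.goldenRatio :=
    (one_le_div (Real.log_pos Real.one_lt_goldenRatio)).2 <|
      Real.log_le_log Real.goldenRatio_pos (by linarith [Real.goldenRatio_lt_two])
  have htime : ((process k st x r).time : ℝ)
      ≤ 1518 * max (st.small.depth : ℝ) st.large.depth + 1649 := by
    exact_mod_cast VarOpt.time_process_le h.wellFormed (le_max_left _ _) (le_max_right _ _) x r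
  calc ((process k st x r).time : ℝ)
      ≤ 3167 * (Real.log (k + 1) / Real.log Real.goldenRatio) := by linarith [h.depth_le]
    _ = 3167 / Real.log Real.goldenRatio * Real.log (k + 1) := by ring

end Invariant

end Invariant

end VarOpt

theorem mainTheorem4 :
    ∃ C : ℝ, ∀ (k : ℕ), 1 ≤ k → ∀ (w r : ℕ → ℝ), (∀ i, 0 < w i) →
      (∀ i, r i ∈ Set.Ioo (0 : ℝ) 1) → ∀ j : ℕ,
        -- worst-case time for processing item `j`
        ((VarOpt.process k (VarOpt.run k w r j) ⟨j, w j⟩ (r j)).time : ℝ)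
          ≤ C * Real.log ((k : ℝ) + 1) ∧
        -- the trees represent the reservoir, with the threshold of the stream seen so far
        VarOpt.Represents k w j (VarOpt.run k w r j) ∧
        -- the first `k` items fill the reservoir
        (j < k → (VarOpt.run k w r (j + 1)).sample.Perm
          ((j, w j) :: (VarOpt.run k w r j).sample)) ∧
        -- any later item leads to the right threshold and the right item being dropped
        (k ≤ j →
          VarOpt.IsRound k ((j, w j) :: (VarOpt.run k w r j).sample) (r j)
            (VarOpt.run k w r (j + 1)).thr (VarOpt.run k w r (j + 1)).sample ∧
          ∀ p ∈ (j, w j) :: (VarOpt.run k w r j).sample,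
            volume {ρ : ℝ | ρ ∈ Set.Ioo (0 : ℝ) 1 ∧
                p.1 ∉ (VarOpt.process k (VarOpt.run k w r j) ⟨j, w j⟩ ρ).val.sample.map Prod.fst}
              = ENNReal.ofReal (1 - min 1 (p.2 / (VarOpt.run k w r (j + 1)).thr))) := by
  refine ⟨3167 / Real.log Real.goldenRatio, fun k hk w r hw hr j => ?_⟩
  have h := VarOpt.Invariant.run hk hw hr j
  refine ⟨h.time_process_le hk _ _, h.represents, fun hj => h.sample_process_perm hj (r j),
    fun hj => ?_⟩
  obtain ⟨τ, U, V, hcut, hperm, hround⟩ := h.process_of_le hk (hw j) hj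
  choose! _ hthr drop hdrop hsample using hround
  rw [VarOpt.run, hthr (r j) (hr j), hsample (r j) (hr j)]
  refine ⟨hcut.isRound (hdrop (r j) (hr j)) hperm (.refl _), fun q hq => ?_⟩
  have hnodup : ((U ++ V).map Prod.fst).Nodup :=
    (hperm.map Prod.fst).nodup_iff.2 (h.nodup_cons (w j))
  rw [← hcut.volume_dropped hnodup hdrop (hperm.symm.subset hq)]
  refine congrArg volume (Set.ext fun ρ => and_congr_right fun hρ => ?_)
  rw [hsample ρ hρ]
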